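/- Let $\pi$ be a Borel probability measure on $(0,\infty)$, write $s\wedge u=\min(s,u)$, and suppose that $$\|\mathcal L_\pi\|_{\mathrm{HS}}:=\Big(\int\!\!\int (x\wedge y)^2\,d\pi(x)\,d\pi(y)\Big)^{1/2}<\infty .$$ Let $\mathcal L_\pi$ be the (then bounded) operator on $L^2(\pi)$ given by $\mathcal L_\pi f(s)=\int f(u)\,(s\wedge u)\,d\pi(u)$, and let $\|\mathcal L_\pi\|$ be its $L^2(\pi)$-operator norm. Let $T^\pi$ be the multitype Galton–Watson tree with ages in which the root has an age with law $\pi$ and in which, independently for different vertices, the ages of the children of a vertex of age $s$ form a Poisson random measure with intensity $(s\wedge u)\,d\pi(u)$. Let $|T^\pi|\in\{1,2,\dots\}\cup\{\infty\}$ be its number of vertices. Then: 1. $\|\mathcal L_\pi\|<1$ if and only if $\mathbb E|T^\pi|<\infty$; 2. $\|\mathcal L_\pi\|=1$ if and only if $\mathbb P(|T^\pi|<\infty)=1$ and $\mathbb E|T^\pi|=\infty$; 3. $\|\mathcal L_\pi\|>1$ if and only if $\mathbb P(|T^\pi|=\infty)>0$. -/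

import Mathlib

open MeasureTheory ProbabilityTheory
open scoped ENNReal NNReal

namespace AgeTree

noncomputable section

/-! ### The branching operator -/

/-- The Hilbert–Schmidt norm `(∫∫ (x ∧ y)² dπ(x) dπ(y))^{1/2}`, with values in `[0, ∞]`. -/
def hsNorm (π : Measure ℝ≥0) : ℝ≥0∞ :=
  (∫⁻ x, ∫⁻ y, ((min x y : ℝ≥0) : ℝ≥0∞) ^ 2 ∂π ∂π) ^ (1 / 2 : ℝ)

/-- The function `s ↦ ∫ f(u) (s ∧ u) dπ(u)`. -/
def branchingFun (π : Measure ℝ≥0) (f : ℝ≥0 → ℝ) (s : ℝ≥0) : ℝ :=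
  ∫ u, f u * ((min s u : ℝ≥0) : ℝ) ∂π

lemma integrable_mul_min (π : Measure ℝ≥0) [IsProbabilityMeasure π] {f : ℝ≥0 → ℝ}
    (hf : MemLp f 2 π) (s : ℝ≥0) :
    Integrable (fun u => f u * ((min s u : ℝ≥0) : ℝ)) π := by
  refine (hf.integrable (by norm_num)).mul_bdd (c := s) (by fun_prop) ?_
  filter_upwards with u
  rw [Real.norm_of_nonneg (by positivity)]
  exact_mod_cast min_le_left s u

lemma aestronglyMeasurable_branchingFun (π : Measure ℝ≥0) [IsProbabilityMeasure π]
    {f : ℝ≥0 → ℝ} (hf : MemLp f 2 π) : AEStronglyMeasurable (branchingFun π f) π := by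
  have h : AEStronglyMeasurable
      (fun p : ℝ≥0 × ℝ≥0 => f p.2 * ((min p.1 p.2 : ℝ≥0) : ℝ)) (π.prod π) :=
    (hf.1.comp_snd).mul (by fun_prop)
  exact h.integral_prod_right'

lemma eLpNorm_branchingFun_le (π : Measure ℝ≥0) [IsProbabilityMeasure π]
    {f : ℝ≥0 → ℝ} (hf : MemLp f 2 π) :
    eLpNorm (branchingFun π f) 2 π ≤ hsNorm π * eLpNorm f 2 π := by
  have hn : ∀ g : ℝ≥0 → ℝ, eLpNorm g 2 π = (∫⁻ x, ‖g x‖ₑ ^ 2 ∂π) ^ (1 / 2 : ℝ) := by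
    intro g
    rw [eLpNorm_eq_lintegral_rpow_enorm_toReal (by norm_num) (by norm_num)]
    norm_num
  have hpt : ∀ s, ‖branchingFun π f s‖ₑ ^ 2 ≤
      (∫⁻ u, ((min s u : ℝ≥0) : ℝ≥0∞) ^ 2 ∂π) * eLpNorm f 2 π ^ 2 := by
    intro s
    have h1 : ‖branchingFun π f s‖ₑ ≤ ∫⁻ u, ‖f u‖ₑ * ((min s u : ℝ≥0) : ℝ≥0∞) ∂π := by
      refine (enorm_integral_le_lintegral_enorm _).trans (lintegral_mono fun u => ?_)
      rw [enorm_mul]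
      rw [Real.enorm_eq_ofReal (NNReal.coe_nonneg _), ENNReal.ofReal_coe_nnreal]
    have h2 := ENNReal.lintegral_mul_le_Lp_mul_Lq π Real.HolderConjugate.two_two
      (f := fun u => ‖f u‖ₑ) (g := fun u => ((min s u : ℝ≥0) : ℝ≥0∞)) hf.1.enorm
      (by fun_prop)
    simp only [Pi.mul_apply, ENNReal.rpow_ofNat] at h2
    have h3 := pow_le_pow_left' (h1.trans h2) 2
    refine h3.trans (le_of_eq ?_)
    rw [mul_pow, hn f, mul_comm]
    congr 1
    rw [← ENNReal.rpow_natCast, ← ENNReal.rpow_mul]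
    norm_num
  have hmeas : Measurable fun s : ℝ≥0 => ∫⁻ u, ((min s u : ℝ≥0) : ℝ≥0∞) ^ 2 ∂π := by
    exact Measurable.lintegral_prod_right'
      (f := fun p : ℝ≥0 × ℝ≥0 => ((min p.1 p.2 : ℝ≥0) : ℝ≥0∞) ^ 2)
      (by fun_prop)
  rw [hn (branchingFun π f)]
  calc (∫⁻ s, ‖branchingFun π f s‖ₑ ^ 2 ∂π) ^ (1 / 2 : ℝ)
      ≤ ((∫⁻ s, ∫⁻ u, ((min s u : ℝ≥0) : ℝ≥0∞) ^ 2 ∂π ∂π) * eLpNorm f 2 π ^ 2) ^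
          (1 / 2 : ℝ) := by
        gcongr
        rw [← lintegral_mul_const _ hmeas]
        exact lintegral_mono hpt
    _ = hsNorm π * eLpNorm f 2 π := by
        rw [ENNReal.mul_rpow_of_nonneg _ _ (by norm_num), hsNorm]
        congr 1
        rw [← ENNReal.rpow_natCast, ← ENNReal.rpow_mul]
        norm_num

lemma memLp_branchingFun (π : Measure ℝ≥0) [IsProbabilityMeasure π] (hπ : hsNorm π < ∞)
    {f : ℝ≥0 → ℝ} (hf : MemLp f 2 π) : MemLp (branchingFun π f) 2 π :=
  ⟨aestronglyMeasurable_branchingFun π hf,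
    (eLpNorm_branchingFun_le π hf).trans_lt (ENNReal.mul_lt_top hπ hf.2)⟩

lemma branchingFun_congr (π : Measure ℝ≥0) {f g : ℝ≥0 → ℝ} (h : f =ᵐ[π] g) :
    branchingFun π f = branchingFun π g := by
  funext s
  refine integral_congr_ae ?_
  filter_upwards [h] with u hu
  rw [hu]

/-- The branching operator `(L f)(s) = ∫ f(u) (s ∧ u) dπ(u)` on `L²(π)`, as a bounded operator;
its norm `‖branchingOp π hπ‖` is the `L²(π)` operator norm. -/
def branchingOp (π : Measure ℝ≥0) [IsProbabilityMeasure π] (hπ : hsNorm π < ∞) :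
    Lp ℝ 2 π →L[ℝ] Lp ℝ 2 π :=
  LinearMap.mkContinuous
    { toFun := fun f => (memLp_branchingFun π hπ (Lp.memLp f)).toLp (branchingFun π f)
      map_add' := fun f g => by
        rw [← MemLp.toLp_add]
        refine MemLp.toLp_congr _ _ (Filter.Eventually.of_forall fun s => ?_)
        rw [branchingFun_congr π (Lp.coeFn_add f g)]
        simp only [branchingFun, Pi.add_apply, add_mul]
        exact integral_add (integrable_mul_min π (Lp.memLp f) s)
          (integrable_mul_min π (Lp.memLp g) s)
      map_smul' := fun c f => by
        rw [RingHom.id_apply, ← MemLp.toLp_const_smul]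
        refine MemLp.toLp_congr _ _ (Filter.Eventually.of_forall fun s => ?_)
        rw [branchingFun_congr π (Lp.coeFn_smul c f)]
        simp only [branchingFun, Pi.smul_apply, smul_eq_mul, mul_assoc]
        exact integral_const_mul _ _ }
    (hsNorm π).toReal
    (fun f => by
      simp only [LinearMap.coe_mk, AddHom.coe_mk, Lp.norm_toLp]
      rw [Lp.norm_def, ← ENNReal.toReal_mul]
      exact ENNReal.toReal_mono (ENNReal.mul_lt_top hπ (Lp.memLp f).2).ne
        (eLpNorm_branchingFun_le π (Lp.memLp f)))

/-! ### Poisson random measures of finite intensity -/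

/-- Finite families of points of `α`: a number `k` of points and the points themselves. -/
abbrev Config (α : Type*) := Σ k : ℕ, (Fin k → α)

lemma measurable_config_mk {α : Type*} [MeasurableSpace α] (k : ℕ) :
    Measurable fun x : Fin k → α => (⟨k, x⟩ : Config α) :=
  Measurable.of_le_map (iInf_le _ k)

lemma measurable_config {α β : Type*} [MeasurableSpace α] [MeasurableSpace β]
    {f : Config α → β} (h : ∀ k, Measurable fun x : Fin k → α => f ⟨k, x⟩) : Measurable f := by
  intro s hs
  rw [Sigma.instMeasurableSpace, MeasurableSpace.measurableSet_iInf]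
  exact fun k => h k hs

/-- The law of (the family of points of) a Poisson random measure with finite intensity `ν`:
the number of points is Poisson with mean `ν(α)`, and given their number the points are
independent with law `ν / ν(α)`; thus `k` points have the joint law
`e^{-ν(α)} / k! * ν^{⊗ k}`. -/
def poissonLaw {α : Type*} [MeasurableSpace α] (ν : Measure α) : Measure (Config α) :=
  Measure.sum fun k : ℕ =>
    (ENNReal.ofReal (Real.exp (-(ν Set.univ).toReal)) / (k.factorial : ℝ≥0∞)) •
      (Measure.pi fun _ : Fin k => ν).map fun x => (⟨k, x⟩ : Config α)

lemma isProbabilityMeasure_poissonLaw {α : Type*} [MeasurableSpace α] (ν : Measure α)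
    [IsFiniteMeasure ν] : IsProbabilityMeasure (poissonLaw ν) := by
  constructor
  rw [poissonLaw, Measure.sum_apply _ MeasurableSet.univ]
  have h : ∀ k : ℕ, ((ENNReal.ofReal (Real.exp (-(ν Set.univ).toReal)) /
      (k.factorial : ℝ≥0∞)) • (Measure.pi fun _ : Fin k => ν).map
        fun x => (⟨k, x⟩ : Config α)) Set.univ =
      ENNReal.ofReal (Real.exp (-(ν Set.univ).toReal) *
        ((ν Set.univ).toReal ^ k / (k.factorial : ℝ))) := by
    intro k
    rw [Measure.smul_apply, Measure.map_apply (measurable_config_mk k) MeasurableSet.univ,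
      Set.preimage_univ, Measure.pi_univ, smul_eq_mul, Finset.prod_const, Finset.card_univ,
      Fintype.card_fin, ENNReal.ofReal_mul (Real.exp_nonneg _),
      ENNReal.ofReal_div_of_pos (by positivity), ENNReal.ofReal_pow ENNReal.toReal_nonneg,
      ENNReal.ofReal_toReal (measure_ne_top _ _), ENNReal.ofReal_natCast, div_eq_mul_inv,
      div_eq_mul_inv]
    ring
  simp_rw [h]
  rw [← ENNReal.ofReal_tsum_of_nonneg (fun k => by positivity)
    ((Real.summable_pow_div_factorial _).mul_left _), tsum_mul_left]
  have he : ∑' k : ℕ, (ν Set.univ).toReal ^ k / (k.factorial : ℝ) =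
      Real.exp ((ν Set.univ).toReal) := by
    rw [Real.exp_eq_exp_ℝ, NormedSpace.exp_eq_tsum_div]
  rw [he, ← Real.exp_add]
  simp

/-! ### Product measures depending measurably on a parameter -/

lemma measurable_measure_pi {α ι : Type*} [Fintype ι] {β : ι → Type*} [MeasurableSpace α]
    [∀ i, MeasurableSpace (β i)] (ν : α → ∀ i, Measure (β i)) [∀ a i, IsFiniteMeasure (ν a i)]
    (hν : ∀ i, Measurable fun a => ν a i) : Measurable fun a => Measure.pi (ν a) := by
  refine Measurable.measure_of_isPiSystem generateFrom_pi.symm isPiSystem_pi ?_ ?_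
  · rintro _ ⟨s, hs, rfl⟩
    simp only [Measure.pi_pi]
    exact Finset.measurable_prod _ fun i _ =>
      (Measure.measurable_coe (hs i (Set.mem_univ i))).comp (hν i)
  · simp only [Measure.pi_univ]
    exact Finset.measurable_prod _ fun i _ =>
      (Measure.measurable_coe MeasurableSet.univ).comp (hν i)

/-! ### The offspring of one vertex -/

/-- The intensity `(s ∧ u) dπ(u)` of the offspring ages of a vertex of age `s`. -/
def offspringIntensity (π : Measure ℝ≥0) (s : ℝ≥0) : Measure ℝ≥0 :=
  π.withDensity fun u => ((min s u : ℝ≥0) : ℝ≥0∞)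

instance (π : Measure ℝ≥0) [IsProbabilityMeasure π] (s : ℝ≥0) :
    IsFiniteMeasure (offspringIntensity π s) := by
  refine isFiniteMeasure_withDensity (ne_of_lt ?_)
  calc ∫⁻ u, ((min s u : ℝ≥0) : ℝ≥0∞) ∂π ≤ ∫⁻ _, (s : ℝ≥0∞) ∂π :=
        lintegral_mono fun u => ENNReal.coe_le_coe.2 (min_le_left s u)
    _ < ∞ := by simp

lemma measurable_offspringIntensity (π : Measure ℝ≥0) [IsProbabilityMeasure π] :
    Measurable (offspringIntensity π) := by
  refine Measure.measurable_of_measurable_coe _ fun B hB => ?_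
  simp only [offspringIntensity, withDensity_apply _ hB]
  exact Measurable.lintegral_prod_right'
    (f := fun p : ℝ≥0 × ℝ≥0 => ((min p.1 p.2 : ℝ≥0) : ℝ≥0∞)) (by fun_prop)

/-- The law of the offspring ages of a vertex, as a kernel from the age `s` of the vertex:
a Poisson random measure with intensity `(s ∧ u) dπ(u)`. -/
def offspringKernel (π : Measure ℝ≥0) [IsProbabilityMeasure π] : Kernel ℝ≥0 (Config ℝ≥0) where
  toFun s := poissonLaw (offspringIntensity π s)
  measurable' := by
    have hm := measurable_offspringIntensity π
    have hu : Measurable fun s => offspringIntensity π s Set.univ :=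
      (Measure.measurable_coe MeasurableSet.univ).comp hm
    refine Measure.measurable_of_measurable_coe _ fun B hB => ?_
    simp only [poissonLaw, Measure.sum_apply _ hB, Measure.smul_apply, smul_eq_mul]
    refine Measurable.tsum fun k => Measurable.mul (by fun_prop) ?_
    simp only [Measure.map_apply (measurable_config_mk k) hB]
    exact (Measure.measurable_coe (measurable_config_mk k hB)).comp
      (measurable_measure_pi (fun s (_ : Fin k) => offspringIntensity π s) fun _ => hm)

instance (π : Measure ℝ≥0) [IsProbabilityMeasure π] : IsMarkovKernel (offspringKernel π) :=
  ⟨fun s => isProbabilityMeasure_poissonLaw (offspringIntensity π s)⟩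

/-! ### The multitype Galton–Watson tree with ages -/

/-- A generation of a rooted tree with ages: its finitely many vertices, each given by a pair
`(p, a)`, where `p` is the position of its parent in the previous generation (`0` for the root)
and `a` is its age. -/
abbrev Generation := Config (ℕ × ℝ≥0)

/-- Given the families `c 0, …, c (k - 1)` of ages of the children of the `k` vertices of a
generation, the next generation, in which the children of vertex `i` have parent position `i`. -/
def nextGeneration {k : ℕ} (c : Fin k → Config ℝ≥0) : Generation :=
  ⟨∑ i, (c i).1, fun j =>
    let q : (i : Fin k) × Fin (c i).1 := finSigmaFinEquiv.symm j
    (q.1, (c q.1).2 q.2)⟩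

lemma measurable_nextGeneration {k : ℕ} :
    Measurable (nextGeneration : (Fin k → Config ℝ≥0) → Generation) := by
  classical
  let g : ∀ n : ℕ, Config ℝ≥0 → (Fin n → ℝ≥0) := fun n c =>
    if h : c.1 = n then fun j => c.2 (Fin.cast h.symm j) else 0
  have hg : ∀ n, Measurable (g n) := by
    intro n
    refine measurable_config fun m => ?_
    by_cases h : m = n
    · subst h
      simp only [g, dite_true]
      exact measurable_id
    · simp only [g, h, dite_false]
      exact measurable_const
  have hsize : Measurable fun c : Config ℝ≥0 => c.1 := measurable_config fun m => measurable_const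
  let A : (Fin k → ℕ) → Set (Fin k → Config ℝ≥0) := fun n => {c | ∀ i, (c i).1 = n i}
  have hA : ∀ n, MeasurableSet (A n) := by
    intro n
    have : A n = ⋂ i, (fun c : Fin k → Config ℝ≥0 => (c i).1) ⁻¹' {n i} := by
      ext c; simp [A]
    rw [this]
    exact MeasurableSet.iInter fun i =>
      (hsize.comp (measurable_pi_apply i)) (measurableSet_singleton _)
  let F : (Fin k → ℕ) → (Fin k → Config ℝ≥0) → Generation := fun n c =>
    ⟨∑ i, n i, fun j =>
      let q : (i : Fin k) × Fin (n i) := finSigmaFinEquiv.symm j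
      (q.1, g (n q.1) (c q.1) q.2)⟩
  have hF : ∀ n, Measurable (F n) := by
    intro n
    refine (measurable_config_mk _).comp (measurable_pi_lambda _ fun j => ?_)
    refine measurable_const.prodMk ?_
    exact (measurable_pi_apply _).comp ((hg _).comp (measurable_pi_apply _))
  have hEq : ∀ n, ∀ c ∈ A n, nextGeneration c = F n c := by
    intro n c hc
    obtain rfl : (fun i => (c i).1) = n := funext hc
    simp only [nextGeneration, F, g, dite_true]
    rfl
  intro B hB
  have : nextGeneration ⁻¹' B = ⋃ n, A n ∩ F n ⁻¹' B := by
    ext c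
    simp only [Set.mem_preimage, Set.mem_iUnion, Set.mem_inter_iff]
    constructor
    · intro h
      refine ⟨fun i => (c i).1, fun i => rfl, ?_⟩
      rwa [← hEq _ c fun i => rfl]
    · rintro ⟨n, hn, h⟩
      rwa [hEq n c hn]
  rw [this]
  exact MeasurableSet.iUnion fun n => (hA n).inter (hF n hB)

/-- The law of the next generation given the current one: the vertices have independent
families of children, a vertex of age `s` according to `offspringKernel π s`. -/
def generationKernel (π : Measure ℝ≥0) [IsProbabilityMeasure π] : Kernel Generation Generation where
  toFun x := (Measure.pi fun i : Fin x.1 => offspringKernel π (x.2 i).2).map nextGeneration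
  measurable' := by
    refine measurable_config fun k => ?_
    refine (Measure.measurable_map _ measurable_nextGeneration).comp ?_
    exact measurable_measure_pi (fun (x : Fin k → ℕ × ℝ≥0) i => offspringKernel π (x i).2)
      fun i => (offspringKernel π).measurable.comp (by fun_prop)

instance (π : Measure ℝ≥0) [IsProbabilityMeasure π] : IsMarkovKernel (generationKernel π) :=
  ⟨fun x => Measure.isProbabilityMeasure_map
    (μ := Measure.pi fun i : Fin x.1 => offspringKernel π (x.2 i).2)
    measurable_nextGeneration.aemeasurable⟩

/-- Rooted trees with ages, as the sequence of their generations. -/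
abbrev Tree := ℕ → Generation

/-- The vertices of a tree: the pairs of a generation and a position in this generation. -/
def Tree.Vertex (t : Tree) : Type := Σ n : ℕ, Fin (t n).1

/-- The number of vertices `|T|`, possibly infinite. -/
def Tree.size (t : Tree) : ℕ∞ := ENat.card t.Vertex

/-- The generation that consists of a root of age `s`. -/
def rootGeneration (s : ℝ≥0) : Generation := ⟨1, fun _ => (0, s)⟩

lemma measurable_rootGeneration : Measurable rootGeneration :=
  (measurable_config_mk 1).comp (by fun_prop)

/-- The law of the multitype Galton–Watson tree with ages `T^π`: the age of the root has law `π`,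
and each generation is obtained from the previous ones by `generationKernel π`. -/
def treeLaw (π : Measure ℝ≥0) [IsProbabilityMeasure π] : Measure Tree :=
  Kernel.trajMeasure (X := fun _ => Generation) (π.map rootGeneration)
    fun n => (generationKernel π).comap (fun x => x ⟨n, Finset.mem_Iic.2 le_rfl⟩)
      (measurable_pi_apply _)

instance (π : Measure ℝ≥0) [IsProbabilityMeasure π] : IsProbabilityMeasure (treeLaw π) := by
  have : IsProbabilityMeasure (π.map rootGeneration) :=
    Measure.isProbabilityMeasure_map measurable_rootGeneration.aemeasurable
  unfold treeLaw
  infer_instance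

end

end AgeTree

namespace AgeTree

open Filter Topology

/-! ### Products and sums over the points of a configuration -/

/-! Write L for the branching operator. Campbell's formula, iterated over generations, gives E|T| =
∑ ⟨1, Lⁿ 1⟩ in L²(π) (`lintegral_size_eq_tsum_inner`). For ‖L‖ < 1 a geometric series dominates this
sum. The Hilbert–Schmidt condition makes L compact; as L is also symmetric and preserves positivity,
‖L‖ ≠ 0 is an eigenvalue with a nonnegative eigenfunction (`exists_nonneg_eigenvector`). For ‖L‖ = 1
this eigenfunction bounds the even terms ⟨1, L²ᵐ 1⟩ away from zero, so the mean is infinite.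

The Poisson generating functional turns survival into a nonlinear iteration: ρ₀ = 1, ρₙ₊₁ = 1 -
exp(-Lρₙ). The ρₙ decrease to a fixed point ρ, and P(|T| = ∞) = ∫ ρ dπ (`treeLaw_size_eq_top`). If
‖L‖ ≤ 1, then ρ ≤ Lρ and ‖Lρ‖ ≤ ‖ρ‖ force Lρ = ρ, so ρ = 1 - exp(-ρ) and ρ = 0 almost everywhere
(`survivalLim_ae_eq_zero`). If ‖L‖ > 1, restrict L to ages at most K so that its norm λ still
exceeds 1, with eigenfunction f. If ρ vanished, Lρₙ would tend to 0 uniformly on [0, K], the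
iteration would be almost linear there, and the positive numbers ∫ ρₙ f would eventually be
nondecreasing while tending to 0 (`survivalLim_not_ae_eq_zero`).

The three ranges of ‖L‖ have mutually exclusive consequences, which yields the converses. -/

lemma lintegral_pi_prod {n : ℕ} {α : Type*} [MeasurableSpace α]
    {μ : Fin n → Measure α} [∀ i, SigmaFinite (μ i)] {f : Fin n → α → ℝ≥0∞}
    (hf : ∀ i, Measurable (f i)) :
    ∫⁻ x : Fin n → α, ∏ i, f i (x i) ∂(Measure.pi μ) = ∏ i, ∫⁻ x, f i x ∂(μ i) := by
  induction n with
  | zero => simp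
  | succ n ih =>
    have hm : ∀ {m : ℕ} (g : Fin m → α → ℝ≥0∞), (∀ i, Measurable (g i)) →
        Measurable fun x : Fin m → α => ∏ i, g i (x i) := fun g hg =>
      Finset.measurable_prod _ fun i _ => (hg i).comp (measurable_pi_apply i)
    have hx : ∀ x : α × (Fin n → α),
        ∏ i, f i ((MeasurableEquiv.piFinSuccAbove (fun _ => α) 0).symm x i) =
          f 0 x.1 * ∏ i : Fin n, f i.succ (x.2 i) := fun x => by
      rw [Fin.prod_univ_succ]
      rfl
    rw [← ((measurePreserving_piFinSuccAbove μ 0).symm).lintegral_comp (hm f hf)]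
    simp_rw [hx]
    rw [Fin.prod_univ_succ, ← ih fun i => hf i.succ]
    exact lintegral_prod_mul (hf 0).aemeasurable (hm _ fun i => hf i.succ).aemeasurable

/-- Since ν is not normalised, each coordinate marginal is ν multiplied by the masses of the other
factors. For empty `ι` the truncated exponent is harmless because the prefactor vanishes. -/
lemma lintegral_pi_sum {ι : Type*} [Fintype ι] {α : Type*} [MeasurableSpace α] {ν : Measure α}
    [SigmaFinite ν] {φ : α → ℝ≥0∞} (hφ : Measurable φ) :
    ∫⁻ x : ι → α, ∑ i, φ (x i) ∂(Measure.pi fun _ => ν) =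
      Fintype.card ι * (ν Set.univ ^ (Fintype.card ι - 1) * ∫⁻ a, φ a ∂ν) := by
  classical
  rw [lintegral_finsetSum (f := fun i (x : ι → α) => φ (x i)) _
    fun i _ => hφ.comp (measurable_pi_apply i)]
  have : ∀ i : ι, ∫⁻ x : ι → α, φ (x i) ∂(Measure.pi fun _ => ν) =
      ν Set.univ ^ (Fintype.card ι - 1) * ∫⁻ a, φ a ∂ν := by
    intro i
    rw [← lintegral_map hφ (measurable_pi_apply i)]
    erw [Measure.pi_map_eval]
    rw [lintegral_smul_measure, Finset.prod_const, Finset.card_erase_of_mem (Finset.mem_univ _),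
      Finset.card_univ, smul_eq_mul]
  simp [this]

lemma lintegral_poissonLaw {α : Type*} [MeasurableSpace α] (ν : Measure α)
    {F : Config α → ℝ≥0∞} (hF : Measurable F) :
    ∫⁻ c, F c ∂(poissonLaw ν) = ∑' k : ℕ,
      ENNReal.ofReal (Real.exp (-(ν Set.univ).toReal)) / (k.factorial : ℝ≥0∞) *
        ∫⁻ x : Fin k → α, F ⟨k, x⟩ ∂(Measure.pi fun _ => ν) := by
  rw [poissonLaw, lintegral_sum_measure]
  refine tsum_congr fun k => ?_
  rw [lintegral_smul_measure, lintegral_map hF (measurable_config_mk k), smul_eq_mul]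

lemma measurable_config_prod {α : Type*} [MeasurableSpace α] {φ : α → ℝ≥0∞} (hφ : Measurable φ) :
    Measurable fun c : Config α => ∏ i, φ (c.2 i) :=
  measurable_config fun k => Finset.measurable_prod
    (f := fun (i : Fin k) (x : Fin k → α) => φ (x i)) Finset.univ
    fun i _ => hφ.comp (measurable_pi_apply i)

lemma measurable_config_sum {α : Type*} [MeasurableSpace α] {φ : α → ℝ≥0∞} (hφ : Measurable φ) :
    Measurable fun c : Config α => ∑ i, φ (c.2 i) :=
  measurable_config fun k => Finset.measurable_sum
    (f := fun (i : Fin k) (x : Fin k → α) => φ (x i)) Finset.univ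
    fun i _ => hφ.comp (measurable_pi_apply i)

lemma tsum_pow_div_factorial_ofReal {x : ℝ} (hx : 0 ≤ x) :
    ∑' k : ℕ, ENNReal.ofReal x ^ k / (k.factorial : ℝ≥0∞) = ENNReal.ofReal (Real.exp x) := by
  rw [Real.exp_eq_exp_ℝ, NormedSpace.exp_eq_tsum_div,
    ENNReal.ofReal_tsum_of_nonneg (fun k => by positivity) (Real.summable_pow_div_factorial _)]
  refine tsum_congr fun k => ?_
  rw [ENNReal.ofReal_div_of_pos (by positivity), ENNReal.ofReal_pow hx, ENNReal.ofReal_natCast]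

/-- The generating functional of a Poisson random measure of finite intensity. -/
lemma lintegral_prod_poissonLaw {α : Type*} [MeasurableSpace α] (ν : Measure α)
    [IsFiniteMeasure ν] {φ : α → ℝ≥0∞} (hφ : Measurable φ) (hφ' : ∫⁻ a, φ a ∂ν ≠ ∞) :
    ∫⁻ c, ∏ i, φ (c.2 i) ∂(poissonLaw ν) =
      ENNReal.ofReal (Real.exp ((∫⁻ a, φ a ∂ν).toReal - (ν Set.univ).toReal)) := by
  rw [lintegral_poissonLaw ν (measurable_config_prod hφ), sub_eq_neg_add, Real.exp_add,
    ENNReal.ofReal_mul (Real.exp_nonneg _), ← tsum_pow_div_factorial_ofReal ENNReal.toReal_nonneg,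
    ENNReal.ofReal_toReal hφ', ← ENNReal.tsum_mul_left]
  refine tsum_congr fun k => ?_
  rw [lintegral_pi_prod fun _ => hφ]
  simp only [Finset.prod_const, Finset.card_univ, Fintype.card_fin, div_eq_mul_inv]
  ring

/-- Campbell's formula for a Poisson random measure of finite intensity. -/
lemma lintegral_sum_poissonLaw {α : Type*} [MeasurableSpace α] (ν : Measure α)
    [IsFiniteMeasure ν] {φ : α → ℝ≥0∞} (hφ : Measurable φ) :
    ∫⁻ c, ∑ i, φ (c.2 i) ∂(poissonLaw ν) = ∫⁻ a, φ a ∂ν := by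
  rw [lintegral_poissonLaw ν (measurable_config_sum hφ)]
  have h : ∀ k : ℕ, ENNReal.ofReal (Real.exp (-(ν Set.univ).toReal)) / (k.factorial : ℝ≥0∞) *
      ∫⁻ x : Fin k → α, ∑ i, φ (x i) ∂(Measure.pi fun _ => ν) =
      (ENNReal.ofReal (Real.exp (-(ν Set.univ).toReal)) * ∫⁻ a, φ a ∂ν) *
        (k * (ν Set.univ ^ (k - 1) / (k.factorial : ℝ≥0∞))) := by
    intro k
    rw [lintegral_pi_sum hφ, Fintype.card_fin]
    simp only [div_eq_mul_inv]
    ring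
  simp_rw [h]
  -- The term k = 0 vanishes; after the shift k / k! becomes 1 / (k - 1)! and the exponential series
  -- reappears.
  rw [ENNReal.tsum_mul_left, tsum_eq_zero_add' ENNReal.summable]
  have h' : ∀ k : ℕ, ((k + 1 : ℕ) : ℝ≥0∞) *
      (ν Set.univ ^ (k + 1 - 1) / ((k + 1).factorial : ℝ≥0∞)) =
      ENNReal.ofReal (ν Set.univ).toReal ^ k / (k.factorial : ℝ≥0∞) := by
    intro k
    rw [ENNReal.ofReal_toReal (measure_ne_top _ _), Nat.factorial_succ, Nat.cast_mul,
      Nat.add_sub_cancel, mul_div_assoc']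
    exact ENNReal.mul_div_mul_left _ _ (by simp) (by simp)
  simp_rw [h']
  rw [tsum_pow_div_factorial_ofReal ENNReal.toReal_nonneg, Nat.cast_zero, zero_mul, zero_add,
    mul_right_comm, ← ENNReal.ofReal_mul (Real.exp_nonneg _), ← Real.exp_add]
  simp

/-! ### One step of the generation process -/

lemma prod_nextGeneration {k : ℕ} (c : Fin k → Config ℝ≥0) (φ : ℝ≥0 → ℝ≥0∞) :
    ∏ j, φ ((nextGeneration c).2 j).2 = ∏ i, ∏ j, φ ((c i).2 j) := by
  rw [← Fintype.prod_sigma' (fun i j => φ ((c i).2 j))]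
  exact Equiv.prod_comp finSigmaFinEquiv.symm
    (fun q : (i : Fin k) × Fin (c i).1 => φ ((c q.1).2 q.2))

lemma sum_nextGeneration {k : ℕ} (c : Fin k → Config ℝ≥0) (φ : ℝ≥0 → ℝ≥0∞) :
    ∑ j, φ ((nextGeneration c).2 j).2 = ∑ i, ∑ j, φ ((c i).2 j) := by
  rw [← Fintype.sum_sigma' (fun i j => φ ((c i).2 j))]
  exact Equiv.sum_comp finSigmaFinEquiv.symm
    (fun q : (i : Fin k) × Fin (c i).1 => φ ((c q.1).2 q.2))

variable (π : Measure ℝ≥0)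

/-- The function `s ↦ ∫ f(u) (s ∧ u) dπ(u)` for `f` with values in `[0, ∞]`. -/
noncomputable def lbranching (f : ℝ≥0 → ℝ≥0∞) (s : ℝ≥0) : ℝ≥0∞ :=
  ∫⁻ u, f u * ((min s u : ℝ≥0) : ℝ≥0∞) ∂π

lemma lintegral_offspringIntensity {φ : ℝ≥0 → ℝ≥0∞} (hφ : Measurable φ) (s : ℝ≥0) :
    ∫⁻ u, φ u ∂(offspringIntensity π s) = lbranching π φ s := by
  rw [offspringIntensity, lintegral_withDensity_eq_lintegral_mul _ (by fun_prop) hφ]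
  exact lintegral_congr fun u => mul_comm _ _

/-- The operator `f ↦ 1 - exp (-∫ f(u) (s ∧ u) dπ(u))` whose iterates at `1` are the probabilities
of surviving `n` generations. -/
noncomputable def survivalStep (f : ℝ≥0 → ℝ) (s : ℝ≥0) : ℝ := 1 - Real.exp (-branchingFun π f s)

/-- The probability that a tree whose root has age `s` survives `n` generations. -/
noncomputable def survival (n : ℕ) : ℝ≥0 → ℝ := (survivalStep π)^[n] 1

lemma branchingFun_nonneg {f : ℝ≥0 → ℝ} (hf : 0 ≤ᵐ[π] f) (s : ℝ≥0) : 0 ≤ branchingFun π f s := by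
  refine integral_nonneg_of_ae ?_
  filter_upwards [hf] with u hu
  exact mul_nonneg hu (NNReal.coe_nonneg _)

lemma survival_succ (n : ℕ) : survival π (n + 1) = survivalStep π (survival π n) :=
  Function.iterate_succ_apply' _ _ _

lemma survivalStep_mem {f : ℝ≥0 → ℝ} (hf : ∀ s, 0 ≤ f s) (s : ℝ≥0) :
    survivalStep π f s ∈ Set.Icc (0 : ℝ) 1 := by
  have := branchingFun_nonneg π (f := f) (Eventually.of_forall hf) s
  constructor
  · rw [survivalStep, sub_nonneg, Real.exp_le_one_iff]
    linarith
  · rw [survivalStep, sub_le_self_iff]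
    positivity

lemma survival_mem (n : ℕ) (s : ℝ≥0) : survival π n s ∈ Set.Icc (0 : ℝ) 1 := by
  induction n generalizing s with
  | zero => simp [survival]
  | succ n ih =>
    rw [survival_succ]
    exact survivalStep_mem π (fun u => (ih u).1) s

variable [IsProbabilityMeasure π]

/-- Independence of the offspring families of distinct vertices; the parent positions play no role.
The additive analogue below uses only the marginals. -/
lemma lintegral_prod_generationKernel (x : Generation) {φ : ℝ≥0 → ℝ≥0∞} (hφ : Measurable φ) :
    ∫⁻ y, ∏ j, φ (y.2 j).2 ∂(generationKernel π x) =
      ∏ i, ∫⁻ c, ∏ j, φ (c.2 j) ∂(offspringKernel π (x.2 i).2) := by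
  have hm : Measurable fun y : Generation => ∏ j, φ (y.2 j).2 :=
    measurable_config_prod (hφ.comp measurable_snd)
  change ∫⁻ y, _ ∂((Measure.pi fun i : Fin x.1 => offspringKernel π (x.2 i).2).map
    nextGeneration) = _
  rw [lintegral_map hm measurable_nextGeneration]
  simp_rw [prod_nextGeneration]
  exact lintegral_pi_prod fun _ => measurable_config_prod hφ

lemma lintegral_sum_generationKernel (x : Generation) {φ : ℝ≥0 → ℝ≥0∞} (hφ : Measurable φ) :
    ∫⁻ y, ∑ j, φ (y.2 j).2 ∂(generationKernel π x) =
      ∑ i, ∫⁻ c, ∑ j, φ (c.2 j) ∂(offspringKernel π (x.2 i).2) := by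
  have hm : Measurable fun y : Generation => ∑ j, φ (y.2 j).2 :=
    measurable_config_sum (hφ.comp measurable_snd)
  change ∫⁻ y, _ ∂((Measure.pi fun i : Fin x.1 => offspringKernel π (x.2 i).2).map
    nextGeneration) = _
  rw [lintegral_map hm measurable_nextGeneration]
  simp_rw [sum_nextGeneration]
  rw [lintegral_finsetSum (f := fun i (c : Fin x.1 → Config ℝ≥0) => ∑ j, φ ((c i).2 j)) _
    fun i _ => (measurable_config_sum hφ).comp (measurable_pi_apply i)]
  refine Finset.sum_congr rfl fun i _ => ?_
  exact (measurePreserving_eval (fun i : Fin x.1 => offspringKernel π (x.2 i).2) i).lintegral_comp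
    (measurable_config_sum hφ)

lemma measurable_lbranching {φ : ℝ≥0 → ℝ≥0∞} (hφ : Measurable φ) :
    Measurable (lbranching π φ) :=
  Measurable.lintegral_prod_right'
    (f := fun p : ℝ≥0 × ℝ≥0 => φ p.2 * ((min p.1 p.2 : ℝ≥0) : ℝ≥0∞)) (by fun_prop)

/-- The mean of an additive functional of the next generation. -/
lemma lintegral_sum_generationKernel' (x : Generation) {φ : ℝ≥0 → ℝ≥0∞} (hφ : Measurable φ) :
    ∫⁻ y, ∑ j, φ (y.2 j).2 ∂(generationKernel π x) = ∑ i, lbranching π φ (x.2 i).2 := by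
  rw [lintegral_sum_generationKernel π x hφ]
  refine Finset.sum_congr rfl fun i _ => ?_
  exact (lintegral_sum_poissonLaw (offspringIntensity π (x.2 i).2) hφ).trans
    (lintegral_offspringIntensity π hφ _)

variable {π} in
lemma measurable_branchingFun {f : ℝ≥0 → ℝ} (hf : Measurable f) :
    Measurable (branchingFun π f) := by
  have h : StronglyMeasurable
      (fun p : ℝ≥0 × ℝ≥0 => f p.2 * ((min p.1 p.2 : ℝ≥0) : ℝ)) :=
    Measurable.stronglyMeasurable (by fun_prop)
  exact h.integral_prod_right'.measurable

lemma measurable_survivalStep {f : ℝ≥0 → ℝ} (hf : Measurable f) :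
    Measurable (survivalStep π f) :=
  (Real.measurable_exp.comp (measurable_branchingFun hf).neg).const_sub 1

lemma measurable_survival (n : ℕ) : Measurable (survival π n) := by
  induction n with
  | zero => exact measurable_const
  | succ n ih =>
    rw [survival_succ]
    exact measurable_survivalStep π ih

lemma memLp_of_mem_Icc {f : ℝ≥0 → ℝ} (hf : Measurable f) (h : ∀ s, f s ∈ Set.Icc (0 : ℝ) 1)
    (p : ℝ≥0∞) : MemLp f p π :=
  memLp_of_bounded (Eventually.of_forall h) hf.aestronglyMeasurable p

/-- The mean of a multiplicative functional of the next generation. -/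
lemma lintegral_prod_generationKernel' (x : Generation) {f : ℝ≥0 → ℝ} (hf : Measurable f)
    (h : ∀ s, f s ∈ Set.Icc (0 : ℝ) 1) :
    ∫⁻ y, ∏ j, ENNReal.ofReal (1 - f (y.2 j).2) ∂(generationKernel π x) =
      ∏ i, ENNReal.ofReal (1 - survivalStep π f (x.2 i).2) := by
  have hm : Measurable fun u => ENNReal.ofReal (1 - f u) := (hf.const_sub 1).ennreal_ofReal
  rw [lintegral_prod_generationKernel π x hm]
  refine Finset.prod_congr rfl fun i _ => ?_
  set s := (x.2 i).2
  have hint := integrable_mul_min π (memLp_of_mem_Icc π hf h 2) s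
  have hint1 : Integrable (fun u : ℝ≥0 => ((min s u : ℝ≥0) : ℝ)) π := by
    simpa using integrable_mul_min π (f := fun _ => 1) (memLp_const 1) s
  -- The integral of 1 - f is the total intensity minus Lf(s), so the exponent in the Poisson
  -- generating functional is -Lf(s).
  have h1 : ∫⁻ u, ENNReal.ofReal (1 - f u) ∂(offspringIntensity π s) =
      ENNReal.ofReal (∫ u, ((min s u : ℝ≥0) : ℝ) ∂π - branchingFun π f s) := by
    rw [lintegral_offspringIntensity π hm, branchingFun, ← integral_sub hint1 hint,
      ofReal_integral_eq_lintegral_ofReal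
        (f := fun u : ℝ≥0 => ((min s u : ℝ≥0) : ℝ) - f u * ((min s u : ℝ≥0) : ℝ))
        (hint1.sub hint)]
    · refine lintegral_congr fun u => ?_
      rw [← ENNReal.ofReal_coe_nnreal, ← ENNReal.ofReal_mul (by linarith [(h u).2])]
      congr 1
      ring
    · filter_upwards with u
      have : f u * ((min s u : ℝ≥0) : ℝ) ≤ 1 * ((min s u : ℝ≥0) : ℝ) :=
        mul_le_mul_of_nonneg_right (h u).2 (NNReal.coe_nonneg _)
      simp only [Pi.zero_apply]
      linarith
  have h2 : offspringIntensity π s Set.univ =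
      ENNReal.ofReal (∫ u, ((min s u : ℝ≥0) : ℝ) ∂π) := by
    rw [← lintegral_one, lintegral_offspringIntensity π measurable_const,
      ofReal_integral_eq_lintegral_ofReal hint1 (Eventually.of_forall fun u => NNReal.coe_nonneg _)]
    exact lintegral_congr fun u => by simp
  have h3 : 0 ≤ ∫ u, ((min s u : ℝ≥0) : ℝ) ∂π - branchingFun π f s := by
    rw [branchingFun, ← integral_sub hint1 hint]
    refine integral_nonneg fun u => ?_
    have : f u * ((min s u : ℝ≥0) : ℝ) ≤ 1 * ((min s u : ℝ≥0) : ℝ) :=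
      mul_le_mul_of_nonneg_right (h u).2 (NNReal.coe_nonneg _)
    simp only [Pi.zero_apply]
    linarith
  have h4 := lintegral_prod_poissonLaw (offspringIntensity π s) hm (by rw [h1]; simp)
  refine h4.trans ?_
  rw [h1, h2, ENNReal.toReal_ofReal h3,
    ENNReal.toReal_ofReal (integral_nonneg fun u => NNReal.coe_nonneg _), survivalStep]
  congr 1
  rw [sub_sub_cancel]
  congr 1
  ring

/-! ### The law of the tree -/

section TreeLaw

variable (π : Measure ℝ≥0) [IsProbabilityMeasure π]

lemma map_treeLaw_zero : (treeLaw π).map (fun t => t 0) = π.map rootGeneration := by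
  have h : (treeLaw π).map (fun t => t 0) =
      ((treeLaw π).map (Preorder.frestrictLe (π := fun _ => Generation) 0)).map
        (fun x => x ⟨0, Finset.mem_Iic.2 le_rfl⟩) := by
    rw [Measure.map_map (by fun_prop) (by fun_prop)]
    rfl
  rw [h, treeLaw, Kernel.trajMeasure, Measure.map_comp _ _ (by fun_prop),
    Kernel.traj_map_frestrictLe, Kernel.partialTraj_self, Measure.id_comp,
    Measure.map_map (by fun_prop) (by fun_prop)]
  exact Measure.map_id

lemma lintegral_treeLaw_zero {F : Generation → ℝ≥0∞} (hF : Measurable F) :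
    ∫⁻ t, F (t 0) ∂(treeLaw π) = ∫⁻ s, F (rootGeneration s) ∂π := by
  rw [← lintegral_map hF (measurable_pi_apply 0), map_treeLaw_zero,
    lintegral_map hF measurable_rootGeneration]

/-- The Markov property of the sequence of generations. -/
lemma lintegral_treeLaw_succ (n : ℕ) {F : Generation × Generation → ℝ≥0∞} (hF : Measurable F) :
    ∫⁻ t, F (t n, t (n + 1)) ∂(treeLaw π) =
      ∫⁻ t, ∫⁻ y, F (t n, y) ∂(generationKernel π (t n)) ∂(treeLaw π) := by
  have : IsProbabilityMeasure (π.map rootGeneration) :=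
    Measure.isProbabilityMeasure_map measurable_rootGeneration.aemeasurable
  have h := Kernel.map_frestrictLe_trajMeasure_compProd_eq_map_trajMeasure
    (X := fun _ => Generation) (μ₀ := π.map rootGeneration)
    (κ := fun n => (generationKernel π).comap (fun x => x ⟨n, Finset.mem_Iic.2 le_rfl⟩)
      (measurable_pi_apply _)) (a := n)
  let G : (Π _ : Finset.Iic n, Generation) × Generation → ℝ≥0∞ := fun p =>
    F (p.1 ⟨n, Finset.mem_Iic.2 le_rfl⟩, p.2)
  have hG : Measurable G := hF.comp (by fun_prop)
  have h' := congrArg (fun μ => ∫⁻ p, G p ∂μ) h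
  rw [lintegral_map hG (by fun_prop), Measure.lintegral_compProd hG,
    lintegral_map hG.lintegral_kernel_prod_right' (by fun_prop)] at h'
  exact h'.symm

lemma lintegral_treeLaw_succ' (n : ℕ) {F : Generation → ℝ≥0∞} (hF : Measurable F) :
    ∫⁻ t, F (t (n + 1)) ∂(treeLaw π) =
      ∫⁻ t, ∫⁻ y, F y ∂(generationKernel π (t n)) ∂(treeLaw π) :=
  lintegral_treeLaw_succ π n (F := fun p => F p.2) (by fun_prop)

/-- The many-to-one formula. Integrating out the last generation replaces φ by Lφ, so the induction
must vary φ. -/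
lemma lintegral_sum_treeLaw (n : ℕ) {φ : ℝ≥0 → ℝ≥0∞} (hφ : Measurable φ) :
    ∫⁻ t, ∑ i, φ ((t n).2 i).2 ∂(treeLaw π) = ∫⁻ s, (lbranching π)^[n] φ s ∂π := by
  have hm : ∀ {φ : ℝ≥0 → ℝ≥0∞}, Measurable φ →
      Measurable fun y : Generation => ∑ j, φ (y.2 j).2 := fun hφ =>
    measurable_config_sum (hφ.comp measurable_snd)
  induction n generalizing φ with
  | zero =>
    rw [lintegral_treeLaw_zero π (hm hφ)]
    refine lintegral_congr fun s => ?_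
    exact Fin.sum_univ_one fun _ => φ s
  | succ n ih =>
    rw [lintegral_treeLaw_succ' π n (hm hφ)]
    simp_rw [lintegral_sum_generationKernel' π _ hφ]
    rw [ih (measurable_lbranching π hφ), Function.iterate_succ_apply]

/-- The multiplicative counterpart: integrating out the last generation replaces f by `survivalStep
π f`. -/
lemma lintegral_prod_treeLaw (n : ℕ) {f : ℝ≥0 → ℝ} (hf : Measurable f)
    (h : ∀ s, f s ∈ Set.Icc (0 : ℝ) 1) :
    ∫⁻ t, ∏ i, ENNReal.ofReal (1 - f ((t n).2 i).2) ∂(treeLaw π) =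
      ∫⁻ s, ENNReal.ofReal (1 - (survivalStep π)^[n] f s) ∂π := by
  have hm : ∀ {f : ℝ≥0 → ℝ}, Measurable f →
      Measurable fun y : Generation => ∏ j, ENNReal.ofReal (1 - f (y.2 j).2) := fun hf =>
    measurable_config_prod ((hf.const_sub 1).ennreal_ofReal.comp measurable_snd)
  induction n generalizing f with
  | zero =>
    rw [lintegral_treeLaw_zero π (hm hf)]
    refine lintegral_congr fun s => ?_
    exact Fin.prod_univ_one fun _ => ENNReal.ofReal (1 - f s)
  | succ n ih =>
    rw [lintegral_treeLaw_succ' π n (hm hf)]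
    simp_rw [lintegral_prod_generationKernel' π _ hf h]
    rw [ih (measurable_survivalStep π hf) (survivalStep_mem π fun s => (h s).1),
      Function.iterate_succ_apply]

lemma measurable_generation_card : Measurable fun x : Generation => x.1 :=
  measurable_config fun _ => measurable_const

/-- The mean number of vertices of a generation. -/
lemma lintegral_generation_card (n : ℕ) :
    ∫⁻ t, ((t n).1 : ℝ≥0∞) ∂(treeLaw π) = ∫⁻ s, (lbranching π)^[n] 1 s ∂π := by
  rw [← lintegral_sum_treeLaw π n measurable_one]
  simp

lemma treeLaw_generation_nonempty (n : ℕ) :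
    treeLaw π {t | (t n).1 ≠ 0} = ∫⁻ s, ENNReal.ofReal (survival π n s) ∂π := by
  have hms : MeasurableSet {t : Tree | (t n).1 = 0} :=
    (measurable_generation_card.comp (measurable_pi_apply n)) (measurableSet_singleton 0)
  -- With f = 1 every factor is 0, so the product is the indicator of an empty generation.
  have h := lintegral_prod_treeLaw π n (f := 1) measurable_one (by simp)
  have h1 : ∫⁻ t, ∏ i, ENNReal.ofReal (1 - (1 : ℝ≥0 → ℝ) ((t n).2 i).2) ∂(treeLaw π) =
      treeLaw π {t | (t n).1 = 0} := by
    rw [← lintegral_indicator_one hms]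
    refine lintegral_congr fun t => ?_
    simp [Set.indicator_apply, zero_pow_eq]
  rw [h1] at h
  change _ = ∫⁻ s, ENNReal.ofReal (1 - survival π n s) ∂π at h
  have h2 : ∫⁻ s, ENNReal.ofReal (1 - survival π n s) ∂π +
      ∫⁻ s, ENNReal.ofReal (survival π n s) ∂π = 1 := by
    rw [← lintegral_add_right _ (measurable_survival π n).ennreal_ofReal]
    have : ∀ s, ENNReal.ofReal (1 - survival π n s) + ENNReal.ofReal (survival π n s) = 1 := by
      intro s
      rw [← ENNReal.ofReal_add (by linarith [(survival_mem π n s).2]) (survival_mem π n s).1]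
      simp
    simp [this]
  have h3 : treeLaw π {t | (t n).1 = 0} + treeLaw π {t | (t n).1 ≠ 0} = 1 := by
    rw [← prob_add_prob_compl (μ := treeLaw π) hms]
    rfl
  rw [h, ← h2] at h3
  refine (ENNReal.add_right_inj (ne_top_of_le_ne_top ENNReal.one_ne_top ?_)).1 h3
  exact h2 ▸ le_self_add

/-- Almost surely, once a generation is empty all later ones are empty. -/
lemma ae_generation_absorbing :
    ∀ᵐ t ∂(treeLaw π), ∀ n m, n ≤ m → (t n).1 = 0 → (t m).1 = 0 := by
  have key : ∀ n : ℕ, ∀ᵐ t ∂(treeLaw π), (t n).1 = 0 → (t (n + 1)).1 = 0 := by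
    intro n
    have hc : Measurable fun x : Generation => (x.1 : ℝ≥0∞) :=
      (measurable_of_countable _).comp measurable_generation_card
    have hc' : Measurable fun x : Generation => (0 : ℝ≥0∞) ^ x.1 :=
      (measurable_of_countable fun k : ℕ => (0 : ℝ≥0∞) ^ k).comp measurable_generation_card
    -- As 0 ^ 0 = 1, this test function is nonzero exactly when the first generation is empty and
    -- the second is not. Its mean over a step vanishes.
    have hF : Measurable fun p : Generation × Generation => (0 : ℝ≥0∞) ^ p.1.1 * (p.2.1 : ℝ≥0∞) :=
      (hc'.comp measurable_fst).mul (hc.comp measurable_snd)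
    have h := lintegral_treeLaw_succ π n hF
    have h0 : ∀ x : Generation,
        ∫⁻ y : Generation, (0 : ℝ≥0∞) ^ x.1 * (y.1 : ℝ≥0∞) ∂(generationKernel π x) = 0 := by
      intro x
      rw [lintegral_const_mul _ hc]
      have := lintegral_sum_generationKernel' π x (φ := 1) measurable_one
      simp only [Pi.one_apply, Finset.sum_const, Finset.card_univ, Fintype.card_fin,
        nsmul_eq_mul, mul_one] at this
      rw [this]
      rcases x with ⟨k, x⟩
      rcases Nat.eq_zero_or_pos k with rfl | hk
      · simp
      · simp [hk.ne']
    simp only [h0, lintegral_zero] at h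
    have h' := (lintegral_eq_zero_iff
      (hF.comp (f := fun t : Tree => (t n, t (n + 1))) (by fun_prop))).1 h
    filter_upwards [h'] with t ht h0
    simpa [h0] using ht
  filter_upwards [ae_all_iff.2 key] with t ht n m hnm h0
  induction m, hnm using Nat.le_induction with
  | base => exact h0
  | succ m _ ih => exact ht m ih

lemma Tree.size_eq_tsum (t : Tree) : (t.size : ℝ≥0∞) = ∑' n, ((t n).1 : ℝ≥0∞) := by
  have h : (t.size : ℝ≥0∞) = ∑' _ : t.Vertex, (1 : ℝ≥0∞) := by
    rw [ENNReal.tsum_const, mul_one]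
    rfl
  rw [h]
  change ∑' _ : (Σ n : ℕ, Fin (t n).1), (1 : ℝ≥0∞) = _
  rw [ENNReal.tsum_sigma fun n (_ : Fin (t n).1) => 1]
  simp

lemma lintegral_size : ∫⁻ t, (Tree.size t : ℝ≥0∞) ∂(treeLaw π) =
    ∑' n, ∫⁻ s, (lbranching π)^[n] 1 s ∂π := by
  simp_rw [Tree.size_eq_tsum, ← lintegral_generation_card]
  exact lintegral_tsum fun n => ((measurable_of_countable _).comp
    (measurable_generation_card.comp (measurable_pi_apply n))).aemeasurable

/-- Only an almost sure statement: a general sequence of generations may become nonempty again after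
an empty one. Absorption leaves a finite sum of generation sizes. -/
lemma ae_size_eq_top_iff :
    ∀ᵐ t ∂(treeLaw π), Tree.size t = ⊤ ↔ ∀ n, (t n).1 ≠ 0 := by
  filter_upwards [ae_generation_absorbing π] with t ht
  rw [← ENat.toENNReal_eq_top, Tree.size_eq_tsum]
  constructor
  · intro h n hn
    refine (lt_top_iff_ne_top.1 ?_) h
    rw [tsum_eq_sum (s := Finset.range n)]
    · exact ENNReal.sum_lt_top.2 fun i _ => ENNReal.natCast_lt_top _
    · intro m hm
      simp [ht n m (by simpa using hm) hn]
  · intro h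
    refine top_unique ?_
    calc (⊤ : ℝ≥0∞) = ∑' _ : ℕ, (1 : ℝ≥0∞) := by simp
      _ ≤ _ := ENNReal.tsum_le_tsum fun n => by
        exact_mod_cast Nat.one_le_iff_ne_zero.2 (h n)

/-- The probability that the tree is infinite is the limit of the probabilities to survive. -/
lemma tendsto_survival_treeLaw :
    Tendsto (fun n => ∫⁻ s, ENNReal.ofReal (survival π n s) ∂π) atTop
      (𝓝 (treeLaw π {t | Tree.size t = ⊤})) := by
  -- The events that generation n is nonempty decrease only almost surely. These sets decrease
  -- everywhere, as continuity from above requires here.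
  let A : ℕ → Set Tree := fun n => {t | ∀ m ≤ n, (t m).1 ≠ 0}
  have hA : ∀ n, MeasurableSet (A n) := by
    intro n
    have : A n = ⋂ m, ⋂ (_ : m ≤ n), {t : Tree | (t m).1 = 0}ᶜ := by
      ext t; simp [A]
    rw [this]
    exact MeasurableSet.iInter fun m => MeasurableSet.iInter fun _ =>
      ((measurable_generation_card.comp (measurable_pi_apply m))
        (measurableSet_singleton 0)).compl
  have h1 : ∀ n, ∫⁻ s, ENNReal.ofReal (survival π n s) ∂π = treeLaw π (A n) := by
    intro n
    rw [← treeLaw_generation_nonempty]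
    refine measure_congr ?_
    filter_upwards [ae_generation_absorbing π] with t ht
    exact propext ⟨fun h m hm h0 => h (ht m n hm h0), fun h => h n le_rfl⟩
  have h2 : treeLaw π {t | Tree.size t = ⊤} = treeLaw π (⋂ n, A n) := by
    refine measure_congr ?_
    filter_upwards [ae_size_eq_top_iff π] with t ht
    refine propext (ht.trans ?_)
    simp only [A]
    constructor
    · exact fun h => Set.mem_iInter.2 fun n m _ => h m
    · exact fun h n => Set.mem_iInter.1 h n n le_rfl
  simp_rw [h1, h2]
  exact tendsto_measure_iInter_atTop (fun n => (hA n).nullMeasurableSet)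
    (fun n m hnm t ht k hk => ht k (hk.trans hnm)) ⟨0, measure_ne_top _ _⟩

end TreeLaw

/-! ### Positive symmetric compact operators on `L²` -/

section Abstract

variable {α : Type*} [MeasurableSpace α] {μ : Measure α}

/-- Dominated convergence for |Fₙ - G|², with majorant 4B². -/
lemma tendsto_Lp_two_of_dominated {F : ℕ → Lp ℝ 2 μ} {G : Lp ℝ 2 μ} {B : α → ℝ}
    (hB : MemLp B 2 μ) (hF : ∀ n, ∀ᵐ x ∂μ, |F n x| ≤ B x)
    (hlim : ∀ᵐ x ∂μ, Tendsto (fun n => F n x) atTop (𝓝 (G x))) : Tendsto F atTop (𝓝 G) := by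
  have hG : ∀ᵐ x ∂μ, |G x| ≤ B x := by
    filter_upwards [hlim, ae_all_iff.2 hF] with x hx hFx
    exact le_of_tendsto hx.abs (Eventually.of_forall hFx)
  have h : Tendsto (fun n => ∫ x, (F n x - G x) ^ 2 ∂μ) atTop (𝓝 (∫ _, (0 : ℝ) ∂μ)) := by
    refine tendsto_integral_of_dominated_convergence (fun x => 4 * B x ^ 2)
      (fun n => (((Lp.aestronglyMeasurable (F n)).sub (Lp.aestronglyMeasurable G)).pow 2))
      (hB.integrable_sq.const_mul 4) (fun n => ?_) ?_
    · filter_upwards [hF n, hG] with x h1 h2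
      rw [Real.norm_eq_abs, abs_pow]
      have : |F n x - G x| ≤ 2 * B x := (abs_sub _ _).trans (by linarith)
      calc |F n x - G x| ^ 2 ≤ (2 * B x) ^ 2 := pow_le_pow_left₀ (abs_nonneg _) this 2
        _ = 4 * B x ^ 2 := by ring
    · filter_upwards [hlim] with x hx
      simpa using (hx.sub_const (G x)).pow 2
  rw [tendsto_iff_norm_sub_tendsto_zero]
  have h' : ∀ n, ‖F n - G‖ = Real.sqrt (∫ x, (F n x - G x) ^ 2 ∂μ) := by
    intro n
    rw [← Real.sqrt_sq (norm_nonneg (F n - G)), ← real_inner_self_eq_norm_sq, L2.inner_def]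
    congr 1
    refine integral_congr_ae ?_
    filter_upwards [Lp.coeFn_sub (F n) G] with x hx
    rw [hx]
    simp [sq]
  simp_rw [h']
  simpa using h.sqrt

local notation "⟪" x ", " y "⟫" => inner ℝ x y

/-- Expand the square: by symmetry the cross term is a multiple of ‖Tf‖², and ‖T(Tf)‖ ≤ ‖T‖ ‖Tf‖.
Hence a near-maximiser of ‖Tf‖ on the unit ball is nearly an eigenvector of T². -/
lemma norm_sq_apply_apply_sub_le {E : Type*} [NormedAddCommGroup E] [InnerProductSpace ℝ E]
    (T : E →L[ℝ] E) (hT : ∀ f g, ⟪T f, g⟫ = ⟪f, T g⟫) (f : E) :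
    ‖T (T f) - ‖T‖ ^ 2 • f‖ ^ 2 ≤ ‖T‖ ^ 2 * (‖T‖ ^ 2 * ‖f‖ ^ 2 - ‖T f‖ ^ 2) := by
  rw [norm_sub_sq_real, inner_smul_right, hT (T f) f, real_inner_self_eq_norm_sq, norm_smul,
    Real.norm_of_nonneg (by positivity)]
  have h1 : ‖T (T f)‖ ^ 2 ≤ (‖T‖ * ‖T f‖) ^ 2 :=
    pow_le_pow_left₀ (norm_nonneg _) (T.le_opNorm _) 2
  nlinarith

lemma abs_apply_le {T : Lp ℝ 2 μ →L[ℝ] Lp ℝ 2 μ} (hpos : ∀ f, 0 ≤ f → 0 ≤ T f) (f : Lp ℝ 2 μ) :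
    |T f| ≤ T |f| := by
  refine abs_le'.2 ⟨?_, ?_⟩
  · have := hpos (|f| - f) (sub_nonneg.2 (le_abs_self f))
    rwa [map_sub, sub_nonneg] at this
  · have := hpos (|f| + f) (by rw [← sub_neg_eq_add]; exact sub_nonneg.2 (neg_le_abs f))
    rw [map_add] at this
    exact neg_le_iff_add_nonneg.2 this

/-- A nonzero symmetric compact operator on `L²` that preserves positivity has a nonnegative
eigenfunction for the eigenvalue given by its norm. -/
theorem exists_nonneg_eigenvector (T : Lp ℝ 2 μ →L[ℝ] Lp ℝ 2 μ)
    (hsym : ∀ f g, ⟪T f, g⟫ = ⟪f, T g⟫) (hpos : ∀ f, 0 ≤ f → 0 ≤ T f)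
    (hcomp : ∀ f : ℕ → Lp ℝ 2 μ, (∀ n, ‖f n‖ ≤ 1) →
      ∃ g, ∃ φ : ℕ → ℕ, StrictMono φ ∧ Tendsto (fun n => T (f (φ n))) atTop (𝓝 g))
    (hT : 0 < ‖T‖) : ∃ h : Lp ℝ 2 μ, 0 ≤ h ∧ h ≠ 0 ∧ T h = ‖T‖ • h := by
  obtain ⟨r, -, hr, hrT⟩ := exists_seq_strictMono_tendsto ‖T‖
  choose f hf1 hf2 using fun n => T.exists_lt_apply_of_lt_opNorm (hr n)
  obtain ⟨g, φ, hφ, hg⟩ := hcomp f fun n => (hf1 n).le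
  have hTf : Tendsto (fun n => ‖T (f (φ n))‖) atTop (𝓝 ‖T‖) :=
    tendsto_of_tendsto_of_tendsto_of_le_of_le (hrT.comp hφ.tendsto_atTop) tendsto_const_nhds
      (fun n => (hf2 _).le) (fun n => T.unit_le_opNorm _ (hf1 _).le)
  have hz : Tendsto (fun n => T (T (f (φ n))) - ‖T‖ ^ 2 • f (φ n)) atTop (𝓝 0) := by
    rw [tendsto_zero_iff_norm_tendsto_zero]
    have h1 : Tendsto (fun n => Real.sqrt (‖T‖ ^ 2 * (‖T‖ ^ 2 - ‖T (f (φ n))‖ ^ 2))) atTop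
        (𝓝 0) := by
      have h2 := (((hTf.pow 2).const_sub (‖T‖ ^ 2)).const_mul (‖T‖ ^ 2)).sqrt
      rwa [sub_self, mul_zero, Real.sqrt_zero] at h2
    refine squeeze_zero (fun n => norm_nonneg _) (fun n => ?_) h1
    refine Real.le_sqrt_of_sq_le ((norm_sq_apply_apply_sub_le T hsym _).trans ?_)
    have : ‖f (φ n)‖ ^ 2 ≤ 1 := pow_le_one₀ (norm_nonneg _) (hf1 _).le
    gcongr
    nlinarith [sq_nonneg ‖T‖]
  -- T²fₙ converges by compactness and differs from ‖T‖² fₙ by a null sequence, so the maximising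
  -- sequence itself converges and the norm is attained.
  have hlim : Tendsto (fun n => f (φ n)) atTop (𝓝 ((‖T‖ ^ 2)⁻¹ • T g)) := by
    have h1 := ((T.continuous.tendsto g).comp hg).sub hz
    have h2 := h1.const_smul (‖T‖ ^ 2)⁻¹
    simpa [smul_smul, inv_mul_cancel₀ (pow_pos hT 2).ne'] using h2
  set f₀ := (‖T‖ ^ 2)⁻¹ • T g
  have hn1 : ‖f₀‖ ≤ 1 := le_of_tendsto hlim.norm (Eventually.of_forall fun n => (hf1 _).le)
  have hn2 : ‖T f₀‖ = ‖T‖ :=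
    tendsto_nhds_unique ((T.continuous.tendsto f₀).comp hlim).norm hTf
  -- Positivity gives |T f₀| ≤ T |f₀|, so |f₀| is a maximiser too, and the estimate above makes it
  -- an exact eigenvector of T².
  have hn3 : ‖T‖ ≤ ‖T |f₀|‖ := by
    rw [← hn2]
    refine norm_le_norm_of_abs_le_abs ((abs_apply_le hpos f₀).trans (le_abs_self _))
  have habs : ‖|f₀|‖ ≤ 1 := by rwa [norm_abs_eq_norm]
  have hTT : T (T |f₀|) = ‖T‖ ^ 2 • |f₀| := by
    rw [← sub_eq_zero, ← norm_eq_zero, ← sq_eq_zero_iff]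
    refine le_antisymm ((norm_sq_apply_apply_sub_le T hsym _).trans ?_) (sq_nonneg _)
    have h1 : ‖|f₀|‖ ^ 2 ≤ 1 := pow_le_one₀ (norm_nonneg _) habs
    have h2 : ‖T‖ ^ 2 ≤ ‖T |f₀|‖ ^ 2 := pow_le_pow_left₀ (norm_nonneg _) hn3 2
    refine mul_nonpos_of_nonneg_of_nonpos (sq_nonneg _) ?_
    nlinarith [sq_nonneg ‖T‖]
  have hT0 : 0 ≤ T |f₀| := hpos _ (abs_nonneg _)
  have hs0 : 0 ≤ ‖T‖ • |f₀| := by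
    rw [← Lp.coeFn_nonneg]
    filter_upwards [Lp.coeFn_smul ‖T‖ |f₀|, (Lp.coeFn_nonneg _).2 (abs_nonneg f₀)] with x h1 h2
    rw [h1]
    exact mul_nonneg hT.le h2
  -- Since (T - ‖T‖)(T + ‖T‖) annihilates |f₀|, the vector (T + ‖T‖)|f₀| is an eigenvector for ‖T‖.
  -- Both summands are nonnegative, so they cannot cancel.
  refine ⟨T |f₀| + ‖T‖ • |f₀|, add_nonneg hT0 hs0, fun h => ?_, ?_⟩
  · have h1 : T |f₀| = 0 := le_antisymm (h ▸ le_add_of_nonneg_right hs0) hT0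
    rw [h1, norm_zero] at hn3
    exact hT.not_ge hn3
  · rw [map_add, map_smul, hTT, smul_add, smul_smul, sq, add_comm]

end Abstract

/-! ### Truncation -/

section Truncation

variable (π : Measure ℝ≥0)

local notation "⟪" x ", " y "⟫" => inner ℝ x y

/-- Multiplication by the indicator function of `A` on `L²(π)`. -/
noncomputable def indicatorOp {A : Set ℝ≥0} (hA : MeasurableSet A) : Lp ℝ 2 π →L[ℝ] Lp ℝ 2 π :=
  LinearMap.mkContinuous
    { toFun := fun f => ((Lp.memLp f).indicator hA).toLp (A.indicator f)
      map_add' := fun f g => by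
        rw [← MemLp.toLp_add]
        refine MemLp.toLp_congr _ _ ?_
        filter_upwards [Lp.coeFn_add f g] with s hs
        rw [Pi.add_apply]
        by_cases h : s ∈ A
        · simp only [Set.indicator_of_mem h]
          exact hs
        · simp [h]
      map_smul' := fun c f => by
        rw [RingHom.id_apply, ← MemLp.toLp_const_smul]
        refine MemLp.toLp_congr _ _ ?_
        filter_upwards [Lp.coeFn_smul c f] with s hs
        rw [Pi.smul_apply]
        by_cases h : s ∈ A
        · simp only [Set.indicator_of_mem h]
          exact hs
        · simp [h] }
    1
    (fun f => by
      simp only [LinearMap.coe_mk, AddHom.coe_mk, Lp.norm_toLp, one_mul]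
      rw [Lp.norm_def]
      exact ENNReal.toReal_mono (Lp.memLp f).2.ne (eLpNorm_indicator_le _))

variable {A : Set ℝ≥0} (hA : MeasurableSet A)

lemma indicatorOp_apply (f : Lp ℝ 2 π) :
    indicatorOp π hA f = ((Lp.memLp f).indicator hA).toLp (A.indicator f) := rfl

lemma coeFn_indicatorOp (f : Lp ℝ 2 π) : indicatorOp π hA f =ᵐ[π] A.indicator f := by
  rw [indicatorOp_apply]
  exact MemLp.coeFn_toLp _

lemma norm_indicatorOp_le (f : Lp ℝ 2 π) : ‖indicatorOp π hA f‖ ≤ ‖f‖ := by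
  have := (indicatorOp π hA).le_of_opNorm_le (LinearMap.mkContinuous_norm_le _ zero_le_one _) f
  simpa using this

lemma indicatorOp_nonneg (f : Lp ℝ 2 π) (hf : 0 ≤ f) : 0 ≤ indicatorOp π hA f := by
  rw [← Lp.coeFn_nonneg]
  filter_upwards [coeFn_indicatorOp π hA f, (Lp.coeFn_nonneg f).2 hf] with s hs h
  rw [hs]
  exact Set.indicator_apply_nonneg fun _ => h

lemma inner_indicatorOp (f g : Lp ℝ 2 π) :
    ⟪indicatorOp π hA f, g⟫ = ⟪f, indicatorOp π hA g⟫ := by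
  rw [L2.inner_def, L2.inner_def]
  refine integral_congr_ae ?_
  filter_upwards [coeFn_indicatorOp π hA f, coeFn_indicatorOp π hA g] with s h1 h2
  rw [h1, h2]
  by_cases hs : s ∈ A <;> simp [hs]

lemma tendsto_indicatorOp (f : Lp ℝ 2 π) :
    Tendsto (fun n : ℕ => indicatorOp π (measurableSet_Iic (a := (n : ℝ≥0))) f) atTop (𝓝 f) := by
  refine tendsto_Lp_two_of_dominated (Lp.memLp f).abs (fun n => ?_) ?_
  · filter_upwards [coeFn_indicatorOp π (measurableSet_Iic (a := (n : ℝ≥0))) f] with s hs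
    rw [hs, Set.indicator_apply]
    split_ifs <;> simp
  · filter_upwards [ae_all_iff.2 fun n : ℕ =>
      coeFn_indicatorOp π (measurableSet_Iic (a := (n : ℝ≥0))) f] with s hs
    obtain ⟨N, hN⟩ := exists_nat_ge s
    refine tendsto_const_nhds.congr' ?_
    filter_upwards [eventually_ge_atTop N] with n hn
    rw [hs n, Set.indicator_of_mem]
    exact hN.trans (by exact_mod_cast hn)

end Truncation

/-! ### The branching operator is symmetric, positive and compact -/

section Operator

variable (π : Measure ℝ≥0) [IsProbabilityMeasure π]

local notation "⟪" x ", " y "⟫" => inner ℝ x y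

lemma integrable_min_sq (hπ : hsNorm π < ∞) :
    Integrable (fun p : ℝ≥0 × ℝ≥0 => ((min p.1 p.2 : ℝ≥0) : ℝ) ^ 2) (π.prod π) := by
  refine ⟨Measurable.aestronglyMeasurable (by fun_prop), ?_⟩
  rw [HasFiniteIntegral, lintegral_prod _ (by fun_prop)]
  have h := (ENNReal.rpow_lt_top_iff_of_pos (by norm_num)).1 hπ
  refine lt_of_eq_of_lt (lintegral_congr fun s => lintegral_congr fun u => ?_) h
  rw [enorm_pow, Real.enorm_eq_ofReal (NNReal.coe_nonneg _), ENNReal.ofReal_coe_nnreal]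

lemma memLp_min (s : ℝ≥0) : MemLp (fun u : ℝ≥0 => ((min s u : ℝ≥0) : ℝ)) 2 π := by
  refine memLp_of_bounded (a := 0) (b := s) (Eventually.of_forall fun u => ?_)
    (Measurable.aestronglyMeasurable (by fun_prop)) 2
  exact ⟨NNReal.coe_nonneg _, NNReal.coe_le_coe.2 (min_le_left s u)⟩

/-- Pairing with the kernel section at s makes pointwise values of Lf weakly continuous in f and
bounded by Cauchy–Schwarz. -/
lemma branchingFun_eq_inner (f : Lp ℝ 2 π) (s : ℝ≥0) :
    branchingFun π f s = ⟪(memLp_min π s).toLp, f⟫ := by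
  rw [L2.inner_def]
  refine integral_congr_ae ?_
  filter_upwards [(memLp_min π s).coeFn_toLp] with u hu
  rw [hu]
  simp

lemma norm_min_toLp (s : ℝ≥0) :
    ‖(memLp_min π s).toLp‖ = Real.sqrt (∫ u, ((min s u : ℝ≥0) : ℝ) ^ 2 ∂π) := by
  rw [← Real.sqrt_sq (norm_nonneg (memLp_min π s).toLp), ← real_inner_self_eq_norm_sq,
    L2.inner_def]
  congr 1
  refine integral_congr_ae ?_
  filter_upwards [(memLp_min π s).coeFn_toLp] with u hu
  rw [hu]
  simp [sq]

/-- This is the Hilbert–Schmidt condition, read as square integrability of the norms of the kernel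
sections; it supplies the majorant for compactness. -/
lemma memLp_norm_min_toLp (hπ : hsNorm π < ∞) :
    MemLp (fun s : ℝ≥0 => ‖(memLp_min π s).toLp‖) 2 π := by
  simp_rw [norm_min_toLp]
  have h := (integrable_min_sq π hπ).integral_prod_left
  have hm : AEStronglyMeasurable
      (fun s : ℝ≥0 => Real.sqrt (∫ u, ((min s u : ℝ≥0) : ℝ) ^ 2 ∂π)) π :=
    Real.continuous_sqrt.comp_aestronglyMeasurable h.1
  refine (memLp_two_iff_integrable_sq hm).2 (h.congr (Eventually.of_forall fun s => ?_))
  exact (Real.sq_sqrt (integral_nonneg fun u => sq_nonneg _)).symm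

variable (hπ : hsNorm π < ∞)

lemma coeFn_branchingOp (f : Lp ℝ 2 π) : branchingOp π hπ f =ᵐ[π] branchingFun π f :=
  MemLp.coeFn_toLp (memLp_branchingFun π hπ (Lp.memLp f))

lemma inner_branchingOp (f g : Lp ℝ 2 π) :
    ⟪branchingOp π hπ f, g⟫ = ⟪f, branchingOp π hπ g⟫ := by
  -- Symmetry is Fubini; integrability holds because both f ⊗ g and the kernel lie in L²(π ⊗ π).
  have hint : Integrable (fun p : ℝ≥0 × ℝ≥0 =>
      f p.2 * g p.1 * ((min p.1 p.2 : ℝ≥0) : ℝ)) (π.prod π) := by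
    have h1 : MemLp (fun p : ℝ≥0 × ℝ≥0 => f p.2 * g p.1) 2 (π.prod π) := by
      refine (memLp_two_iff_integrable_sq ((Lp.aestronglyMeasurable f).comp_snd.mul
        (Lp.aestronglyMeasurable g).comp_fst)).2 ?_
      refine ((Lp.memLp g).integrable_sq.mul_prod (Lp.memLp f).integrable_sq).congr
        (Eventually.of_forall fun p => ?_)
      simp only [Pi.mul_apply]
      ring
    have h2 : MemLp (fun p : ℝ≥0 × ℝ≥0 => ((min p.1 p.2 : ℝ≥0) : ℝ)) 2 (π.prod π) :=
      (memLp_two_iff_integrable_sq (Measurable.aestronglyMeasurable (by fun_prop))).2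
        (integrable_min_sq π hπ)
    exact h1.integrable_mul h2
  rw [L2.inner_def, L2.inner_def]
  have h1 : ∫ s, ⟪branchingOp π hπ f s, g s⟫ ∂π =
      ∫ s, ∫ u, f u * g s * ((min s u : ℝ≥0) : ℝ) ∂π ∂π := by
    refine integral_congr_ae ?_
    filter_upwards [coeFn_branchingOp π hπ f] with s hs
    rw [hs, branchingFun]
    simp only [RCLike.inner_apply, conj_trivial]
    rw [← integral_const_mul]
    refine integral_congr_ae (Eventually.of_forall fun u => ?_)
    simp only
    ring
  have h2 : ∫ u, ⟪f u, branchingOp π hπ g u⟫ ∂π =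
      ∫ u, ∫ s, f u * g s * ((min s u : ℝ≥0) : ℝ) ∂π ∂π := by
    refine integral_congr_ae ?_
    filter_upwards [coeFn_branchingOp π hπ g] with u hu
    rw [hu, branchingFun]
    simp only [RCLike.inner_apply, conj_trivial]
    rw [← integral_mul_const]
    refine integral_congr_ae (Eventually.of_forall fun s => ?_)
    simp only [min_comm u s]
    ring
  rw [h1, h2]
  exact integral_integral_swap hint

lemma branchingOp_nonneg (f : Lp ℝ 2 π) (hf : 0 ≤ f) : 0 ≤ branchingOp π hπ f := by
  rw [← Lp.coeFn_nonneg]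
  filter_upwards [coeFn_branchingOp π hπ f] with s hs
  rw [hs]
  exact branchingFun_nonneg π ((Lp.coeFn_nonneg f).2 hf) s

/-- Sequential Banach–Alaoglu and the Riesz isometry give a weakly convergent subsequence. Its
images under L converge pointwise, dominated by the norms of the kernel sections, hence in L². -/
lemma branchingOp_compact (f : ℕ → Lp ℝ 2 π) (hf : ∀ n, ‖f n‖ ≤ 1) :
    ∃ g, ∃ φ : ℕ → ℕ, StrictMono φ ∧
      Tendsto (fun n => branchingOp π hπ (f (φ n))) atTop (𝓝 g) := by
  have : Fact ((2 : ℝ≥0∞) ≠ ∞) := ⟨ENNReal.ofNat_ne_top⟩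
  obtain ⟨a, -, φ, hφ, ha⟩ := WeakDual.isSeqCompact_closedBall ℝ (Lp ℝ 2 π) 0 1
    (x := fun n => StrongDual.toWeakDual (InnerProductSpace.toDual ℝ (Lp ℝ 2 π) (f n)))
    (fun n => by simpa using hf n)
  let f₀ : Lp ℝ 2 π := (InnerProductSpace.toDual ℝ (Lp ℝ 2 π)).symm (WeakDual.toStrongDual a)
  have hw : ∀ v : Lp ℝ 2 π, Tendsto (fun n => ⟪v, f (φ n)⟫) atTop (𝓝 ⟪v, f₀⟫) := by
    intro v
    have h1 := ((WeakDual.eval_continuous (𝕜 := ℝ) v).tendsto a).comp ha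
    simp_rw [fun g => real_inner_comm g v]
    have h2 : ⟪f₀, v⟫ = a v := InnerProductSpace.toDual_symm_apply
    rw [h2]
    exact h1
  refine ⟨branchingOp π hπ f₀, φ, hφ, ?_⟩
  refine tendsto_Lp_two_of_dominated (memLp_norm_min_toLp π hπ) (fun n => ?_) ?_
  · filter_upwards [coeFn_branchingOp π hπ (f (φ n))] with s hs
    rw [hs, branchingFun_eq_inner]
    refine (abs_real_inner_le_norm _ _).trans ?_
    exact mul_le_of_le_one_right (norm_nonneg _) (hf _)
  · filter_upwards [coeFn_branchingOp π hπ f₀,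
      ae_all_iff.2 fun n => coeFn_branchingOp π hπ (f (φ n))] with s h1 h2
    simp_rw [h1, h2, branchingFun_eq_inner]
    exact hw _

variable {A : Set ℝ≥0} (hA : MeasurableSet A)

/-- The branching operator restricted to the ages in `A`. -/
noncomputable def truncatedOp : Lp ℝ 2 π →L[ℝ] Lp ℝ 2 π :=
  indicatorOp π hA ∘L branchingOp π hπ ∘L indicatorOp π hA

lemma truncatedOp_apply (f : Lp ℝ 2 π) :
    truncatedOp π hπ hA f = indicatorOp π hA (branchingOp π hπ (indicatorOp π hA f)) := rfl

/-- The truncated operators converge strongly to L, so a unit-ball vector f with ‖Lf‖ > r also works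
for a large truncation level. -/
lemma exists_norm_truncatedOp_gt {r : ℝ} (h : r < ‖branchingOp π hπ‖) :
    ∃ n : ℕ, r < ‖truncatedOp π hπ (measurableSet_Iic (a := (n : ℝ≥0)))‖ := by
  obtain ⟨f, hf1, hf2⟩ := (branchingOp π hπ).exists_lt_apply_of_lt_opNorm h
  have hlim : Tendsto (fun n : ℕ => truncatedOp π hπ (measurableSet_Iic (a := (n : ℝ≥0))) f) atTop
      (𝓝 (branchingOp π hπ f)) := by
    have h1 := tendsto_indicatorOp π (branchingOp π hπ f)
    have h2 : Tendsto (fun n : ℕ => indicatorOp π (measurableSet_Iic (a := (n : ℝ≥0)))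
        (branchingOp π hπ (indicatorOp π (measurableSet_Iic (a := (n : ℝ≥0))) f -  f)))
        atTop (𝓝 0) := by
      have h3 := ((branchingOp π hπ).continuous.tendsto 0).comp
        (tendsto_sub_nhds_zero_iff.2 (tendsto_indicatorOp π f))
      rw [map_zero] at h3
      exact squeeze_zero_norm (fun n => norm_indicatorOp_le π _ _)
        (tendsto_zero_iff_norm_tendsto_zero.1 h3)
    have h4 := h2.add h1
    rw [zero_add] at h4
    refine h4.congr fun n => ?_
    rw [truncatedOp_apply, map_sub, map_sub, sub_add_cancel]
  obtain ⟨n, hn⟩ := (hlim.norm.eventually_const_lt hf2).exists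
  exact ⟨n, hn.trans_le (ContinuousLinearMap.unit_le_opNorm _ _ hf1.le)⟩

lemma exists_truncatedOp_eigenvector (h : 0 < ‖truncatedOp π hπ hA‖) :
    ∃ h : Lp ℝ 2 π, 0 ≤ h ∧ h ≠ 0 ∧ truncatedOp π hπ hA h = ‖truncatedOp π hπ hA‖ • h := by
  refine exists_nonneg_eigenvector _ (fun f g => ?_) (fun f hf => ?_) (fun f hf => ?_) h
  · rw [truncatedOp_apply, truncatedOp_apply, inner_indicatorOp, inner_branchingOp,
      inner_indicatorOp]
  · exact indicatorOp_nonneg π hA _ (branchingOp_nonneg π hπ _ (indicatorOp_nonneg π hA _ hf))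
  · obtain ⟨g, φ, hφ, hg⟩ := branchingOp_compact π hπ (fun n => indicatorOp π hA (f n))
      fun n => (norm_indicatorOp_le π hA _).trans (hf n)
    exact ⟨indicatorOp π hA g, φ, hφ, ((indicatorOp π hA).continuous.tendsto g).comp hg⟩

lemma exists_branchingOp_eigenvector (h : 0 < ‖branchingOp π hπ‖) :
    ∃ h : Lp ℝ 2 π, 0 ≤ h ∧ h ≠ 0 ∧ branchingOp π hπ h = ‖branchingOp π hπ‖ • h :=
  exists_nonneg_eigenvector _ (inner_branchingOp π hπ) (branchingOp_nonneg π hπ)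
    (branchingOp_compact π hπ) h

end Operator

/-! ### The expected size of the tree -/

section Criticality

variable (π : Measure ℝ≥0) [IsProbabilityMeasure π] (hπ : hsNorm π < ∞)

local notation "⟪" x ", " y "⟫" => inner ℝ x y

/-- The constant function `1` in `L²(π)`. -/
noncomputable def oneLp : Lp ℝ 2 π := (memLp_const (1 : ℝ)).toLp

lemma coeFn_oneLp : oneLp π =ᵐ[π] fun _ => (1 : ℝ) := MemLp.coeFn_toLp _

lemma oneLp_nonneg : 0 ≤ oneLp π := by
  rw [← Lp.coeFn_nonneg]
  filter_upwards [coeFn_oneLp π] with s hs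
  simp [hs]

lemma inner_oneLp (f : Lp ℝ 2 π) : ⟪oneLp π, f⟫ = ∫ s, f s ∂π := by
  rw [L2.inner_def]
  refine integral_congr_ae ?_
  filter_upwards [coeFn_oneLp π] with s hs
  simp [hs]

lemma norm_oneLp : ‖oneLp π‖ = 1 := by
  rw [← sq_eq_sq₀ (norm_nonneg _) zero_le_one, ← real_inner_self_eq_norm_sq, inner_oneLp,
    integral_congr_ae (coeFn_oneLp π)]
  simp

lemma integrable_Lp (f : Lp ℝ 2 π) : Integrable f π := (Lp.memLp f).integrable (by norm_num)

lemma pow_branchingOp_nonneg (n : ℕ) (f : Lp ℝ 2 π) (hf : 0 ≤ f) :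
    0 ≤ (branchingOp π hπ ^ n) f := by
  induction n with
  | zero => exact hf
  | succ n ih =>
    rw [pow_succ']
    exact branchingOp_nonneg π hπ _ ih

lemma iterate_lbranching_one (n : ℕ) :
    (lbranching π)^[n] 1 =ᵐ[π] fun s => ENNReal.ofReal ((branchingOp π hπ ^ n) (oneLp π) s) := by
  induction n with
  | zero =>
    filter_upwards [coeFn_oneLp π] with s hs
    change _ = ENNReal.ofReal (oneLp π s)
    simp [hs]
  | succ n ih =>
    rw [Function.iterate_succ_apply', pow_succ']
    change _ =ᵐ[π] fun s => ENNReal.ofReal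
      (branchingOp π hπ ((branchingOp π hπ ^ n) (oneLp π)) s)
    set f := (branchingOp π hπ ^ n) (oneLp π)
    have hf : 0 ≤ᵐ[π] f :=
      (Lp.coeFn_nonneg f).2 (pow_branchingOp_nonneg π hπ n _ (oneLp_nonneg π))
    filter_upwards [coeFn_branchingOp π hπ f] with s hs
    rw [hs, branchingFun, ofReal_integral_eq_lintegral_ofReal
      (integrable_mul_min π (Lp.memLp f) s), lbranching]
    · refine lintegral_congr_ae ?_
      filter_upwards [ih, hf] with u hu h0
      rw [hu, ENNReal.ofReal_mul h0, ENNReal.ofReal_coe_nnreal]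
    · filter_upwards [hf] with u h0
      exact mul_nonneg h0 (NNReal.coe_nonneg _)

/-- The expected size of the tree is `∑ ⟨1, Lⁿ 1⟩`. -/
lemma lintegral_size_eq_tsum_inner : ∫⁻ t, (Tree.size t : ℝ≥0∞) ∂(treeLaw π) =
    ∑' n, ENNReal.ofReal ⟪oneLp π, (branchingOp π hπ ^ n) (oneLp π)⟫ := by
  rw [lintegral_size]
  refine tsum_congr fun n => ?_
  rw [inner_oneLp, lintegral_congr_ae (iterate_lbranching_one π hπ n),
    ofReal_integral_eq_lintegral_ofReal (integrable_Lp π _)]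
  exact (Lp.coeFn_nonneg _).2 (pow_branchingOp_nonneg π hπ n _ (oneLp_nonneg π))

lemma lintegral_size_lt_top (h : ‖branchingOp π hπ‖ < 1) :
    ∫⁻ t, (Tree.size t : ℝ≥0∞) ∂(treeLaw π) < ∞ := by
  rw [lintegral_size_eq_tsum_inner π hπ]
  have hle : ∀ n, ⟪oneLp π, (branchingOp π hπ ^ n) (oneLp π)⟫ ≤ ‖branchingOp π hπ‖ ^ n := by
    intro n
    refine (real_inner_le_norm _ _).trans ?_
    rw [norm_oneLp, one_mul]
    rcases Nat.eq_zero_or_pos n with rfl | hn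
    · exact (norm_oneLp π).le.trans (pow_zero _).ge
    · refine (ContinuousLinearMap.unit_le_opNorm _ _ (norm_oneLp π).le).trans ?_
      exact norm_pow_le' _ hn
  calc ∑' n, ENNReal.ofReal ⟪oneLp π, (branchingOp π hπ ^ n) (oneLp π)⟫
      ≤ ∑' n, ENNReal.ofReal (‖branchingOp π hπ‖ ^ n) :=
        ENNReal.tsum_le_tsum fun n => ENNReal.ofReal_le_ofReal (hle n)
    _ = ENNReal.ofReal (∑' n, ‖branchingOp π hπ‖ ^ n) :=
        (ENNReal.ofReal_tsum_of_nonneg (fun n => by positivity)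
          (summable_geometric_of_lt_one (norm_nonneg _) h)).symm
    _ < ∞ := ENNReal.ofReal_lt_top

lemma inner_pow_branchingOp (n : ℕ) (f g : Lp ℝ 2 π) :
    ⟪(branchingOp π hπ ^ n) f, g⟫ = ⟪f, (branchingOp π hπ ^ n) g⟫ := by
  induction n generalizing f g with
  | zero => rfl
  | succ n ih =>
    nth_rw 1 [pow_succ']
    rw [pow_succ]
    exact (inner_branchingOp π hπ _ g).trans (ih f _)

lemma integral_pos_of_nonneg_of_ne_zero {f : Lp ℝ 2 π} (hf : 0 ≤ f) (hf0 : f ≠ 0) :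
    0 < ∫ s, f s ∂π := by
  have h0 := (Lp.coeFn_nonneg f).2 hf
  refine lt_of_le_of_ne (integral_nonneg_of_ae h0) fun h => hf0 ?_
  rw [Lp.eq_zero_iff_ae_eq_zero]
  exact (integral_eq_zero_iff_of_nonneg_ae h0 (integrable_Lp π f)).1 h.symm

/-- For a fixed vector f ≥ 0 of L, ⟨1, L²ᵐ 1⟩ = ‖Lᵐ 1‖², while ⟨1, f⟩ = ⟨Lᵐ 1, f⟩ ≤ ‖Lᵐ 1‖ ‖f‖. So
the even terms alone make the series diverge. -/
lemma lintegral_size_eq_top (h : ‖branchingOp π hπ‖ = 1) :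
    ∫⁻ t, (Tree.size t : ℝ≥0∞) ∂(treeLaw π) = ∞ := by
  obtain ⟨f, hf, hf0, hfL⟩ := exists_branchingOp_eigenvector π hπ (by rw [h]; exact one_pos)
  rw [h, one_smul] at hfL
  have hpow : ∀ n, (branchingOp π hπ ^ n) f = f := by
    intro n
    induction n with
    | zero => rfl
    | succ n ih =>
      rw [pow_succ']
      change branchingOp π hπ ((branchingOp π hπ ^ n) f) = f
      rw [ih, hfL]
  have hnf : 0 < ‖f‖ := norm_pos_iff.2 hf0
  have hI : 0 < ⟪oneLp π, f⟫ := by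
    rw [inner_oneLp]
    exact integral_pos_of_nonneg_of_ne_zero π hf hf0
  set c := (⟪oneLp π, f⟫ / ‖f‖) ^ 2 with hc
  have hc0 : 0 < c := by positivity
  have key : ∀ m, c ≤ ⟪oneLp π, (branchingOp π hπ ^ (m + m)) (oneLp π)⟫ := by
    intro m
    have h1 : ⟪oneLp π, (branchingOp π hπ ^ (m + m)) (oneLp π)⟫ =
        ‖(branchingOp π hπ ^ m) (oneLp π)‖ ^ 2 := by
      rw [← real_inner_self_eq_norm_sq, inner_pow_branchingOp, pow_add]
      rfl
    have h2 : ⟪oneLp π, f⟫ ≤ ‖(branchingOp π hπ ^ m) (oneLp π)‖ * ‖f‖ := by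
      conv_lhs => rw [← hpow m]
      rw [← inner_pow_branchingOp]
      exact real_inner_le_norm _ _
    rw [h1, hc]
    exact pow_le_pow_left₀ (by positivity) ((div_le_iff₀ hnf).2 h2) 2
  rw [lintegral_size_eq_tsum_inner π hπ]
  refine top_unique ?_
  calc (∞ : ℝ≥0∞) = ∑' _ : ℕ, ENNReal.ofReal c := by
        rw [ENNReal.tsum_const, ENat.card_eq_top_of_infinite]
        simp [hc0]
    _ ≤ ∑' m : ℕ, ENNReal.ofReal ⟪oneLp π, (branchingOp π hπ ^ (m + m)) (oneLp π)⟫ :=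
        ENNReal.tsum_le_tsum fun m => ENNReal.ofReal_le_ofReal (key m)
    _ ≤ _ := ENNReal.tsum_comp_le_tsum_of_injective
        (f := fun m : ℕ => m + m) (fun a b hab => by simp only at hab; omega)
        (fun n => ENNReal.ofReal ⟪oneLp π, (branchingOp π hπ ^ n) (oneLp π)⟫)

/-! ### The survival probability -/

lemma branchingFun_mono {f g : ℝ≥0 → ℝ} (hf : MemLp f 2 π) (hg : MemLp g 2 π) (h : f ≤ᵐ[π] g)
    (s : ℝ≥0) : branchingFun π f s ≤ branchingFun π g s := by
  refine integral_mono_ae (integrable_mul_min π hf s) (integrable_mul_min π hg s) ?_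
  filter_upwards [h] with u hu
  exact mul_le_mul_of_nonneg_right hu (NNReal.coe_nonneg _)

lemma memLp_survival (n : ℕ) : MemLp (survival π n) 2 π :=
  memLp_of_mem_Icc π (measurable_survival π n) (survival_mem π n) 2

/-- The survival step is monotone and its first iterate lies below the starting function 1. -/
lemma survival_antitone : Antitone (survival π) := by
  refine antitone_nat_of_succ_le fun n => ?_
  induction n with
  | zero => exact fun s => (survival_mem π 1 s).2
  | succ n ih =>
    intro s
    have := branchingFun_mono π (memLp_survival π (n + 1)) (memLp_survival π n)
      (Eventually.of_forall ih) s
    calc survival π (n + 1 + 1) s = 1 - Real.exp (-branchingFun π (survival π (n + 1)) s) :=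
          congrFun (survival_succ π (n + 1)) s
      _ ≤ 1 - Real.exp (-branchingFun π (survival π n) s) := by gcongr
      _ = survival π (n + 1) s := (congrFun (survival_succ π n) s).symm

/-- The probability that the tree with a root of age `s` is infinite. -/
noncomputable def survivalLim (s : ℝ≥0) : ℝ := ⨅ n, survival π n s

lemma tendsto_survival (s : ℝ≥0) :
    Tendsto (fun n => survival π n s) atTop (𝓝 (survivalLim π s)) :=
  tendsto_atTop_ciInf (fun _ _ h => survival_antitone π h s)
    ⟨0, by rintro _ ⟨n, rfl⟩; exact (survival_mem π n s).1⟩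

lemma survivalLim_mem (s : ℝ≥0) : survivalLim π s ∈ Set.Icc (0 : ℝ) 1 :=
  isClosed_Icc.mem_of_tendsto (tendsto_survival π s)
    (Eventually.of_forall fun n => survival_mem π n s)

lemma measurable_survivalLim : Measurable (survivalLim π) :=
  measurable_of_tendsto_metrizable (measurable_survival π)
    (tendsto_pi_nhds.2 (tendsto_survival π))

lemma memLp_survivalLim : MemLp (survivalLim π) 2 π :=
  memLp_of_mem_Icc π (measurable_survivalLim π) (survivalLim_mem π) 2

lemma tendsto_integral_mul_survival {g : ℝ≥0 → ℝ} (hg : Integrable g π) :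
    Tendsto (fun n => ∫ u, survival π n u * g u ∂π) atTop
      (𝓝 (∫ u, survivalLim π u * g u ∂π)) := by
  refine tendsto_integral_of_dominated_convergence (fun u => ‖g u‖)
    (fun n => (measurable_survival π n).aestronglyMeasurable.mul hg.1) hg.norm (fun n => ?_) ?_
  · filter_upwards with u
    rw [norm_mul, Real.norm_of_nonneg (survival_mem π n u).1]
    exact mul_le_of_le_one_left (norm_nonneg _) (survival_mem π n u).2
  · filter_upwards with u
    exact (tendsto_survival π u).mul_const _

lemma survivalLim_eq (s : ℝ≥0) : survivalLim π s = survivalStep π (survivalLim π) s := by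
  have h1 : Integrable (fun u : ℝ≥0 => ((min s u : ℝ≥0) : ℝ)) π :=
    (memLp_min π s).integrable (by norm_num)
  have h2 : Tendsto (fun n => survivalStep π (survival π n) s) atTop
      (𝓝 (survivalStep π (survivalLim π) s)) :=
    ((Real.continuous_exp.tendsto _).comp (tendsto_integral_mul_survival π h1).neg).const_sub 1
  refine tendsto_nhds_unique ((tendsto_survival π s).comp (tendsto_add_atTop_nat 1)) ?_
  refine h2.congr fun n => ?_
  rw [Function.comp_apply, survival_succ]

/-- The tree is almost surely finite if and only if the survival probability vanishes. -/
lemma treeLaw_size_eq_top :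
    treeLaw π {t | Tree.size t = ⊤} = ENNReal.ofReal (∫ s, survivalLim π s ∂π) := by
  refine tendsto_nhds_unique (tendsto_survival_treeLaw π) ?_
  have h := tendsto_integral_mul_survival π (integrable_const (1 : ℝ))
  simp only [mul_one] at h
  refine (ENNReal.tendsto_ofReal h).congr fun n => ?_
  rw [ofReal_integral_eq_lintegral_ofReal ((memLp_survival π n).integrable (by norm_num))]
  exact Eventually.of_forall fun s => (survival_mem π n s).1

lemma treeLaw_size_eq_top_eq_zero_iff :
    treeLaw π {t | Tree.size t = ⊤} = 0 ↔ survivalLim π =ᵐ[π] 0 := by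
  have h0 : 0 ≤ survivalLim π := fun s => (survivalLim_mem π s).1
  rw [treeLaw_size_eq_top, ENNReal.ofReal_eq_zero,
    ← integral_eq_zero_iff_of_nonneg h0 ((memLp_survivalLim π).integrable (by norm_num))]
  exact ⟨fun h => le_antisymm h (integral_nonneg h0), fun h => h.le⟩

/-- From 1 - exp(-x) ≤ x, the fixed point satisfies ρ ≤ Lρ, while the norm bound compares the L²
norms in the opposite direction. Thus Lρ = ρ almost everywhere, and 1 - exp(-x) = x only at x = 0.
-/
lemma survivalLim_ae_eq_zero (h : ‖branchingOp π hπ‖ ≤ 1) : survivalLim π =ᵐ[π] 0 := by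
  have hle : ∀ s, survivalLim π s ≤ branchingFun π (survivalLim π) s := by
    intro s
    rw [survivalLim_eq, survivalStep]
    linarith [Real.add_one_le_exp (-branchingFun π (survivalLim π) s)]
  have h0 : ∀ s, 0 ≤ survivalLim π s := fun s => (survivalLim_mem π s).1
  have hmem := memLp_branchingFun π hπ (memLp_survivalLim π)
  set ρ : Lp ℝ 2 π := (memLp_survivalLim π).toLp
  have hρs : ρ =ᵐ[π] survivalLim π := MemLp.coeFn_toLp _
  have hLρ : branchingOp π hπ ρ =ᵐ[π] branchingFun π (survivalLim π) := by
    filter_upwards [coeFn_branchingOp π hπ ρ] with s hs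
    rw [hs, branchingFun_congr π hρs]
  have hsq : ∀ f : Lp ℝ 2 π, ‖f‖ ^ 2 = ∫ s, f s ^ 2 ∂π := by
    intro f
    rw [← real_inner_self_eq_norm_sq, L2.inner_def]
    simp [sq]
  have h1 : ∫ s, branchingFun π (survivalLim π) s ^ 2 ∂π ≤ ∫ s, survivalLim π s ^ 2 ∂π := by
    have h2 : ‖branchingOp π hπ ρ‖ ^ 2 ≤ ‖ρ‖ ^ 2 := by
      refine pow_le_pow_left₀ (norm_nonneg _) ?_ 2
      exact ((branchingOp π hπ).le_of_opNorm_le h ρ).trans (one_mul _).le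
    rw [hsq, hsq] at h2
    have h3 : ∫ s, branchingOp π hπ ρ s ^ 2 ∂π = ∫ s, branchingFun π (survivalLim π) s ^ 2 ∂π :=
      integral_congr_ae (hLρ.fun_comp (· ^ 2))
    have h4 : ∫ s, ρ s ^ 2 ∂π = ∫ s, survivalLim π s ^ 2 ∂π :=
      integral_congr_ae (hρs.fun_comp (· ^ 2))
    rwa [h3, h4] at h2
  have h3 : (fun s => branchingFun π (survivalLim π) s ^ 2 - survivalLim π s ^ 2) =ᵐ[π] 0 := by
    have hint := hmem.integrable_sq.sub (memLp_survivalLim π).integrable_sq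
    have hnn : 0 ≤ fun s => branchingFun π (survivalLim π) s ^ 2 - survivalLim π s ^ 2 :=
      fun s => sub_nonneg.2 (pow_le_pow_left₀ (h0 s) (hle s) 2)
    refine (integral_eq_zero_iff_of_nonneg hnn hint).1 ?_
    refine le_antisymm ?_ (integral_nonneg hnn)
    rw [integral_sub hmem.integrable_sq (memLp_survivalLim π).integrable_sq]
    linarith
  filter_upwards [h3] with s hs
  have h4 : branchingFun π (survivalLim π) s = survivalLim π s :=
    ((sq_eq_sq₀ (h0 s) ((h0 s).trans (hle s))).1 (sub_eq_zero.1 hs).symm).symm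
  have h5 := survivalLim_eq π s
  rw [survivalStep, h4] at h5
  by_contra hne
  have := Real.add_one_lt_exp (x := -survivalLim π s) (neg_ne_zero.2 hne)
  linarith

/-- A vertex of age 0 has no children, so an atom at 0 has to be excluded; for positive ages the
kernel is strictly positive. -/
lemma survival_pos (hpos : π {0} = 0) (n : ℕ) : ∀ᵐ s ∂π, 0 < survival π n s := by
  have h0 : ∀ᵐ s ∂π, s ≠ 0 := by
    rw [ae_iff]
    simpa using hpos
  induction n with
  | zero => exact Eventually.of_forall fun s => by simp [survival]
  | succ n ih =>
    filter_upwards [h0] with s hs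
    rw [survival_succ, survivalStep, sub_pos, Real.exp_lt_one_iff, neg_lt_zero]
    refine lt_of_le_of_ne (branchingFun_nonneg π
      (Eventually.of_forall fun u => (survival_mem π n u).1) s) fun h => ?_
    have h1 : (fun u => survival π n u * ((min s u : ℝ≥0) : ℝ)) =ᵐ[π] 0 :=
      (integral_eq_zero_iff_of_nonneg
        (fun u => mul_nonneg (survival_mem π n u).1 (NNReal.coe_nonneg _))
        (integrable_mul_min π (memLp_survival π n) s)).1 h.symm
    have h2 : ∀ᵐ _ ∂π, False := by
      filter_upwards [h0, ih, h1] with u hu h3 h4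
      have : 0 < survival π n u * ((min s u : ℝ≥0) : ℝ) :=
        mul_pos h3 (NNReal.coe_pos.2 (lt_min (pos_iff_ne_zero.2 hs) (pos_iff_ne_zero.2 hu)))
      exact this.ne' h4
    obtain ⟨_, h⟩ := h2.exists
    exact h

/-- Combines 1 - exp(-x) ≥ (1 - x)x with x = Lρₙ(s) ≤ K ∫ ρₙ, where s ∧ u ≤ K. The truncation of
ages serves this uniform bound. -/
lemma one_sub_mul_le_survival_succ (n : ℕ) {K : ℝ} {s : ℝ≥0} (hs : (s : ℝ) ≤ K) :
    (1 - K * ∫ u, survival π n u ∂π) * branchingFun π (survival π n) s ≤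
      survival π (n + 1) s := by
  set x := branchingFun π (survival π n) s with hx
  have hx0 : 0 ≤ x := branchingFun_nonneg π
    (Eventually.of_forall fun u => (survival_mem π n u).1) s
  have hint : Integrable (survival π n) π := (memLp_survival π n).integrable (by norm_num)
  have hx1 : x ≤ K * ∫ u, survival π n u ∂π := by
    rw [← integral_const_mul]
    refine integral_mono (integrable_mul_min π (memLp_survival π n) s) (hint.const_mul K)
      fun u => ?_
    rw [mul_comm K]
    refine mul_le_mul_of_nonneg_left ?_ (survival_mem π n u).1
    exact (NNReal.coe_le_coe.2 (min_le_left s u)).trans hs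
  have h1 : (1 - K * ∫ u, survival π n u ∂π) * x ≤ (1 - x) * x :=
    mul_le_mul_of_nonneg_right (by linarith) hx0
  refine h1.trans ?_
  rw [survival_succ, survivalStep, ← hx]
  -- Since (1 + x)(1 - x + x²) = 1 + x³ ≥ 1, this implies exp(-x) ≤ 1 - x + x².
  have h2 : Real.exp (-x) * (1 + x) ≤ 1 := by
    calc Real.exp (-x) * (1 + x) ≤ Real.exp (-x) * Real.exp x := by
          gcongr
          linarith [Real.add_one_le_exp x]
      _ = 1 := by rw [← Real.exp_add]; simp
  nlinarith [Real.exp_pos (-x), mul_nonneg hx0 hx0, mul_nonneg (mul_nonneg hx0 hx0) hx0]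

lemma survivalLim_not_ae_eq_zero (hpos : π {0} = 0) (h : 1 < ‖branchingOp π hπ‖) :
    ¬ survivalLim π =ᵐ[π] 0 := by
  intro hlim
  obtain ⟨K, hK⟩ := exists_norm_truncatedOp_gt π hπ h
  have hA : MeasurableSet (Set.Iic (K : ℝ≥0)) := measurableSet_Iic
  set lam := ‖truncatedOp π hπ hA‖
  obtain ⟨f, hf, hf0, hfT⟩ := exists_truncatedOp_eigenvector π hπ hA (one_pos.trans hK)
  have hfnn : 0 ≤ᵐ[π] f := (Lp.coeFn_nonneg f).2 hf
  have hlam : 0 < lam := one_pos.trans hK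
  have hfT' : ∀ᵐ s ∂π, lam * f s =
      (Set.Iic (K : ℝ≥0)).indicator (branchingFun π (indicatorOp π hA f)) s := by
    have h1 := coeFn_indicatorOp π hA (branchingOp π hπ (indicatorOp π hA f))
    rw [← truncatedOp_apply, hfT] at h1
    filter_upwards [h1, Lp.coeFn_smul lam f,
      coeFn_branchingOp π hπ (indicatorOp π hA f)] with s h2 h3 h4
    rw [h3] at h2
    refine Eq.trans h2 ?_
    simp only [Set.indicator_apply, h4]
  have hsupp : ∀ᵐ s ∂π, s ∉ Set.Iic (K : ℝ≥0) → f s = 0 := by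
    filter_upwards [hfT'] with s hs hsK
    rw [Set.indicator_of_notMem hsK] at hs
    exact (mul_eq_zero.1 hs).resolve_left hlam.ne'
  have hAf : indicatorOp π hA f =ᵐ[π] f := by
    filter_upwards [coeFn_indicatorOp π hA f, hsupp] with s h1 h2
    rw [h1]
    by_cases hs : s ∈ Set.Iic (K : ℝ≥0)
    · rw [Set.indicator_of_mem hs]
    · rw [Set.indicator_of_notMem hs, h2 hs]
  -- The eigenfunction vanishes beyond K, and the outer indicator discards only nonnegative values,
  -- so f is a subsolution for the untruncated operator.
  have hsub : ∀ᵐ s ∂π, lam * f s ≤ branchingFun π f s := by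
    filter_upwards [hfT'] with s hs
    rw [hs, branchingFun_congr π hAf]
    exact Set.indicator_le_self' (fun _ _ => branchingFun_nonneg π hfnn _) s
  let a : ℕ → ℝ := fun n => ∫ s, survival π n s * f s ∂π
  let c : ℕ → ℝ := fun n => ∫ s, survival π n s ∂π
  have hfint := integrable_Lp π f
  have hmulint : ∀ g : ℝ≥0 → ℝ, MemLp g 2 π → Integrable (fun s => g s * f s) π :=
    fun g hg => hg.integrable_mul (Lp.memLp f)
  have ha0 : Tendsto a atTop (𝓝 0) := by
    have h1 := tendsto_integral_mul_survival π hfint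
    rwa [integral_eq_zero_of_ae] at h1
    filter_upwards [hlim] with s hs
    simp [hs]
  have hc0 : Tendsto c atTop (𝓝 0) := by
    have h1 := tendsto_integral_mul_survival π (integrable_const (1 : ℝ))
    simp only [mul_one] at h1
    rwa [integral_eq_zero_of_ae hlim] at h1
  have hapos : ∀ n, 0 < a n := by
    intro n
    have h1 : 0 ≤ᵐ[π] fun s => survival π n s * f s := by
      filter_upwards [hfnn] with s hs
      exact mul_nonneg (survival_mem π n s).1 hs
    refine lt_of_le_of_ne (integral_nonneg_of_ae h1) fun h2 => hf0 ?_
    have h3 := (integral_eq_zero_iff_of_nonneg_ae h1 (hmulint _ (memLp_survival π n))).1 h2.symm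
    rw [Lp.eq_zero_iff_ae_eq_zero]
    filter_upwards [h3, survival_pos π hpos n] with s h4 h5
    exact (mul_eq_zero.1 h4).resolve_left h5.ne'
  have hstep : ∀ n, 0 ≤ 1 - K * c n → (1 - K * c n) * lam * a n ≤ a (n + 1) := by
    intro n hn
    have hsurv := memLp_survival π n
    -- Symmetry moves L onto f, where λf ≤ Lf applies.
    have hself : ∫ s, branchingFun π (survival π n) s * f s ∂π =
        ∫ s, survival π n s * branchingFun π f s ∂π := by
      have h1 := inner_branchingOp π hπ hsurv.toLp f
      rw [L2.inner_def, L2.inner_def] at h1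
      refine Eq.trans (integral_congr_ae ?_) (h1.trans (integral_congr_ae ?_))
      · filter_upwards [coeFn_branchingOp π hπ hsurv.toLp] with s hs
        rw [hs, branchingFun_congr π hsurv.coeFn_toLp]
        simp [mul_comm]
      · filter_upwards [coeFn_branchingOp π hπ f, hsurv.coeFn_toLp] with s hs h2
        rw [hs, h2]
        simp [mul_comm]
    have h1 : lam * a n ≤ ∫ s, branchingFun π (survival π n) s * f s ∂π := by
      rw [hself, ← integral_const_mul]
      refine integral_mono_ae ((hmulint _ hsurv).const_mul lam)
        (hsurv.integrable_mul (memLp_branchingFun π hπ (Lp.memLp f))) ?_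
      filter_upwards [hsub] with s hs
      calc lam * (survival π n s * f s) = survival π n s * (lam * f s) := by ring
        _ ≤ _ := mul_le_mul_of_nonneg_left hs (survival_mem π n s).1
    rw [mul_assoc]
    refine (mul_le_mul_of_nonneg_left h1 hn).trans ?_
    rw [← integral_const_mul]
    refine integral_mono_ae ((hmulint _ (memLp_branchingFun π hπ hsurv)).const_mul _)
      (hmulint _ (memLp_survival π (n + 1))) ?_
    filter_upwards [hsupp, hfnn] with s h2 h3
    rw [← mul_assoc]
    -- The linear lower bound for ρₙ₊₁ is available only on [0, K]; elsewhere f is zero.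
    by_cases hs : s ∈ Set.Iic (K : ℝ≥0)
    · refine mul_le_mul_of_nonneg_right (one_sub_mul_le_survival_succ π n ?_) h3
      exact_mod_cast NNReal.coe_le_coe.2 hs
    · simp [h2 hs]
  -- As the means of ρₙ tend to 0, the loss from linearisation is eventually smaller than the gain λ
  -- > 1.
  have hev : ∀ᶠ n in atTop, 1 < (1 - K * c n) * lam := by
    have h1 : Tendsto (fun n => (1 - K * c n) * lam) atTop (𝓝 ((1 - K * 0) * lam)) :=
      ((hc0.const_mul _).const_sub 1).mul_const _
    rw [mul_zero, sub_zero, one_mul] at h1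
    exact h1.eventually_const_lt hK
  obtain ⟨N, hN⟩ := eventually_atTop.1 hev
  have hmono : ∀ n, N ≤ n → a N ≤ a n := by
    intro n hn
    induction n, hn using Nat.le_induction with
    | base => exact le_rfl
    | succ n hn ih =>
      have h1 := hN n hn
      have h2 : 0 ≤ 1 - K * c n := by
        by_contra h3
        have := mul_neg_of_neg_of_pos (not_le.1 h3) hlam
        linarith
      refine ih.trans (le_trans ?_ (hstep n h2))
      exact le_mul_of_one_le_left (hapos n).le h1.le
  exact (hapos N).not_ge (ge_of_tendsto ha0 (eventually_atTop.2 ⟨N, hmono⟩))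

/-! ### Measurability and almost sure finiteness of the size -/

lemma measurable_size : Measurable fun t : Tree => (Tree.size t : ℝ≥0∞) := by
  simp_rw [Tree.size_eq_tsum]
  exact Measurable.tsum fun n => (measurable_of_countable _).comp
    (measurable_generation_card.comp (measurable_pi_apply n))

lemma treeLaw_size_lt_top_eq_one_iff :
    treeLaw π {t | Tree.size t < ⊤} = 1 ↔ treeLaw π {t | Tree.size t = ⊤} = 0 := by
  have h : {t : Tree | Tree.size t = ⊤} = {t | Tree.size t < ⊤}ᶜ := by
    ext t
    simp
  have hm : NullMeasurableSet {t : Tree | Tree.size t < ⊤} (treeLaw π) := by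
    have : {t : Tree | Tree.size t < ⊤} = (fun t : Tree => (Tree.size t : ℝ≥0∞)) ⁻¹' {∞}ᶜ := by
      ext t
      simp [lt_top_iff_ne_top]
    rw [this]
    exact (measurable_size (measurableSet_singleton _).compl).nullMeasurableSet
  rw [h, prob_compl_eq_zero_iff₀ hm]

lemma treeLaw_size_eq_top_of_lintegral_lt_top
    (h : ∫⁻ t, (Tree.size t : ℝ≥0∞) ∂(treeLaw π) < ∞) :
    treeLaw π {t | Tree.size t = ⊤} = 0 := by
  have h1 := ae_lt_top measurable_size h.ne
  rw [ae_iff] at h1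
  simpa using h1

end Criticality

end AgeTree

theorem mainTheorem6 (π : Measure ℝ≥0) [IsProbabilityMeasure π] (hpos : π {0} = 0)
    (hHS : AgeTree.hsNorm π < ∞) :
    (‖AgeTree.branchingOp π hHS‖ < 1 ↔
      ∫⁻ t, (AgeTree.Tree.size t : ℝ≥0∞) ∂(AgeTree.treeLaw π) < ∞) ∧
    (‖AgeTree.branchingOp π hHS‖ = 1 ↔
      AgeTree.treeLaw π {t | AgeTree.Tree.size t < ⊤} = 1 ∧
        ∫⁻ t, (AgeTree.Tree.size t : ℝ≥0∞) ∂(AgeTree.treeLaw π) = ∞) ∧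
    (1 < ‖AgeTree.branchingOp π hHS‖ ↔
      0 < AgeTree.treeLaw π {t | AgeTree.Tree.size t = ⊤}) := by
  have sub := AgeTree.lintegral_size_lt_top π hHS
  have crit := AgeTree.lintegral_size_eq_top π hHS
  have ext := fun h => (AgeTree.treeLaw_size_eq_top_eq_zero_iff π).2
    (AgeTree.survivalLim_ae_eq_zero π hHS h)
  have sup := fun h => mt (AgeTree.treeLaw_size_eq_top_eq_zero_iff π).1
    (AgeTree.survivalLim_not_ae_eq_zero π hHS hpos h)
  have fin := AgeTree.treeLaw_size_eq_top_of_lintegral_lt_top π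
  rw [AgeTree.treeLaw_size_lt_top_eq_one_iff, pos_iff_ne_zero]
  -- Each converse follows by excluding the other ranges of ‖L‖; a finite mean contradicts ‖L‖ > 1
  -- because it forces almost sure finiteness.
  refine ⟨⟨sub, fun h => ?_⟩, ⟨fun h => ⟨ext h.le, crit h⟩, fun h => ?_⟩, ⟨sup, fun h => ?_⟩⟩
  · by_contra! hge
    rcases hge.eq_or_lt with h1 | h1
    · exact h.ne (crit h1.symm)
    · exact sup h1 (fin h)
  · by_contra hne
    rcases lt_or_gt_of_ne hne with h1 | h1
    · exact (sub h1).ne h.2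
    · exact sup h1 h.1
  · by_contra! hle
    exact h (ext hle)
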